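/- **Setting.** Let $n$ be a dimension. A \emph{modulus of continuity} is a continuous, strictly increasing, concave function $\omega:[0,1]\to\mathbb R$ with $\omega(0)=0$. Consider the conditions * (Dini1) there is $C>0$ such that $\int_0^h \frac{\omega(t)}{t}\,dt\le C\,\omega(h)$ for all $h\in(0,1]$ (in particular the integral is finite); * (TechCond1) there is $C>0$ such that $\dfrac{\omega(2^{-q})}{\omega(2^{-p})}\le C\,\omega(2^{p-q})$ for all integers $1\le p\le q-1$; * (TechCond2) $\sum_{k\ge 0}2^{(1-\sigma)k}\omega(2^{-k})<+\infty$ for all $\sigma\in(0,1)$. $C^\omega(\mathbb R^n)$ is the space of bounded functions $a:\mathbb R^n\to\mathbb C$ with $$\|a\|_{C^\omega}=\|a\|_{L^\infty}+\sup_{0<|x-y|<1}\frac{|a(x)-a(y)|}{\omega(|x-y|)}<+\infty .$$ Let $\chi,\varphi\in C_0^\infty(\mathbb R^n;[0,1])$ satisfy $\operatorname{supp}\chi\subseteq\{|\xi|\le\frac43\}$, $\operatorname{supp}\varphi\subseteq\{\frac34\le|\xi|\le\frac83\}$ and $\chi(\xi)+\sum_{q\ge0}\varphi(2^{-q}\xi)=1$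 for all $\xi$. On $\mathcal S'(\mathbb R^n)$ put $\Delta_q=0$ for $q\le-2$, $\Delta_{-1}=\chi(D)$, $\Delta_q=\varphi(2^{-q}D)$ for $q\ge0$, and $S_q=\chi(2^{-q}D)=\sum_{p\le q-1}\Delta_p$ for $q\ge0$, $S_q=0$ for $q<0$, where $D=-i\partial$. For $s\in\mathbb R$ let $H^s_\Omega(\mathbb R^n)$ be the set of $u\in\mathcal S'(\mathbb R^n)$ with $$\|u\|_{H^s_\Omega}=\Big(\sum_{q\ge-1}2^{2sq}\,\Omega(q)^2\,\|\Delta_qu\|_{L^2}^2\Big)^{1/2}<+\infty,\qquad \Omega(q)=2^q\omega(2^{-q}),$$ where $\omega(2)$, which occurs only for $q=-1$, is read as $\omega(1)$. For $q\ge-1$ define $$\mathcal R^{(1)}_q(a,b)=\sum_{|q'-q|\le4}[\Delta_q,S_{q'-1}a]\Delta_{q'}b,\qquad \mathcal R^{(2)}_q(a,b)=\sum_{|q'-q|\le4}(S_{q'-1}a-S_{q-1}a)\Delta_q\Delta_{q'}b,$$ $$\mathcal R^{(3)}_q(a,b)=\sum_{q'>q-4}\Delta_q\big(S_{q'+2}b\,\Delta_{q'}a\big),$$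 where $[\Delta_q,f]w=\Delta_q(fw)-f\Delta_qw$. **Statement.** Let $\omega$ be a modulus of continuity satisfying (Dini1) and let $s\in\mathbb R$. There is a constant $C$, depending only on $n,\chi,\varphi,\omega,s$, such that for all $a\in C^\omega(\mathbb R^n)$, all $b\in H^{-s}_\Omega(\mathbb R^n)$ and $i=1,2$, $$\Big(\sum_{q\ge-1}2^{2(1-s)q}\,\big\|\mathcal R^{(i)}_q(a,b)\big\|_{L^2}^2\Big)^{1/2}\le C\,\|a\|_{C^\omega}\,\|b\|_{H^{-s}_\Omega}.\qquad(*)$$ If moreover $s\in(0,1)$ and $\omega$ satisfies (TechCond1) and (TechCond2), then, for all such $a$ and $b$ and all $q\ge-1$, the series defining $\mathcal R^{(3)}_q(a,b)$ converges unconditionally in $\mathcal S'(\mathbb R^n)$, and $(*)$ holds also for $i=3$, with a constant $C$ depending only on $n,\chi,\varphi,\omega,s$. -/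

import Mathlib

open MeasureTheory SchwartzMap TemperedDistribution
open scoped ENNReal NNReal

noncomputable section

namespace Paradiff

/-- Euclidean space `ℝⁿ`. -/
abbrev Rn (n : ℕ) : Type := EuclideanSpace ℝ (Fin n)

/-! ### Moduli of continuity

A modulus of continuity is a function on `[0,1]`; it is represented by a function `ℝ → ℝ` of which
only the values on `[0,1]` are ever used. -/

/-- Continuous, strictly increasing, concave on `[0,1]`, and zero at the origin. -/
structure IsModulus (ω : ℝ → ℝ) : Prop where
  continuousOn : ContinuousOn ω (Set.Icc 0 1)
  strictMonoOn : StrictMonoOn ω (Set.Icc 0 1)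
  concaveOn : ConcaveOn ℝ (Set.Icc 0 1) ω
  map_zero : ω 0 = 0

/-- The Dini type condition `∫₀ʰ ω(t)/t dt ≤ C ω(h)` for `h ∈ (0,1]` (the integral being finite). -/
def DiniCondition (ω : ℝ → ℝ) : Prop :=
  ∃ C : ℝ, 0 < C ∧ ∀ h ∈ Set.Ioc (0 : ℝ) 1,
    IntegrableOn (fun t ↦ ω t / t) (Set.Ioc 0 h) ∧ ∫ t in Set.Ioc 0 h, ω t / t ≤ C * ω h

/-- `ω(2^{-q}) / ω(2^{-p}) ≤ C ω(2^{p-q})` for all integers `1 ≤ p ≤ q - 1`. -/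
def QuotientCondition (ω : ℝ → ℝ) : Prop :=
  ∃ C : ℝ, 0 < C ∧ ∀ p q : ℤ, 1 ≤ p → p ≤ q - 1 →
    ω ((2 : ℝ) ^ (-q)) / ω ((2 : ℝ) ^ (-p)) ≤ C * ω ((2 : ℝ) ^ (p - q))

/-- `∑_{k ≥ 0} 2^{(1-σ)k} ω(2^{-k}) < ∞` for all `σ ∈ (0,1)`. -/
def SeriesCondition (ω : ℝ → ℝ) : Prop :=
  ∀ σ ∈ Set.Ioo (0 : ℝ) 1,
    Summable fun k : ℕ ↦ (2 : ℝ) ^ ((1 - σ) * (k : ℝ)) * ω ((2 : ℝ) ^ (-(k : ℤ)))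

/-- The weight `Ω(q) = 2^q ω(2^{-q})`, where `ω` is extended by `ω(t) = ω(1)` for `t > 1`
(this concerns only `q = -1`, where `2^{-q} = 2` lies outside `[0,1]`). -/
def Omega (ω : ℝ → ℝ) (q : ℤ) : ℝ := (2 : ℝ) ^ q * ω (min 1 ((2 : ℝ) ^ (-q)))

/-! ### The space `C^ω(ℝⁿ)` -/

/-- `sup_{0 < |x-y| < 1} |a(x) - a(y)| / ω(|x-y|)`. -/
def seminormC {n : ℕ} (ω : ℝ → ℝ) (a : Rn n → ℂ) : ℝ≥0∞ :=
  ⨆ (x : Rn n) (y : Rn n) (_ : 0 < dist x y ∧ dist x y < 1),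
    ‖a x - a y‖ₑ / ENNReal.ofReal (ω (dist x y))

/-- `‖a‖_{C^ω} = ‖a‖_{L^∞} + sup_{0 < |x-y| < 1} |a(x) - a(y)| / ω(|x-y|)`. -/
def normC {n : ℕ} (ω : ℝ → ℝ) (a : Rn n → ℂ) : ℝ≥0∞ :=
  eLpNorm a ∞ volume + seminormC ω a

/-- `a ∈ C^ω(ℝⁿ)`: `a` is bounded and its `C^ω` seminorm is finite. -/
structure MemC {n : ℕ} (ω : ℝ → ℝ) (a : Rn n → ℂ) : Prop where
  bounded : ∃ M : ℝ, ∀ x, ‖a x‖ ≤ M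
  seminorm_lt_top : seminormC ω a < ∞

theorem MemC.continuous {n : ℕ} {ω : ℝ → ℝ} (hω : IsModulus ω) {a : Rn n → ℂ}
    (ha : MemC ω a) : Continuous a := by
  rw [continuous_iff_continuousAt]
  intro x
  obtain ⟨K, hK⟩ : ∃ K : ℝ≥0, seminormC ω a = K :=
    ⟨(seminormC ω a).toNNReal, (ENNReal.coe_toNNReal ha.seminorm_lt_top.ne).symm⟩
  have key : ∀ y ∈ Metric.ball x 1, dist (a y) (a x) ≤ K * ω (dist y x) := by
    intro y hy
    rcases eq_or_ne y x with rfl | hne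
    · simp [hω.map_zero]
    have h0 : 0 < dist y x := dist_pos.mpr hne
    have h1 : dist y x < 1 := hy
    have hpos : 0 < ω (dist y x) := by
      have := hω.strictMonoOn (show (0 : ℝ) ∈ Set.Icc 0 1 by simp) ⟨h0.le, h1.le⟩ h0
      rwa [hω.map_zero] at this
    have hle : ‖a y - a x‖ₑ / ENNReal.ofReal (ω (dist y x)) ≤ K := by
      rw [← hK]
      exact le_iSup_of_le y (le_iSup_of_le x (le_iSup_of_le ⟨h0, h1⟩ le_rfl))
    rw [ENNReal.div_le_iff (by simpa using hpos) (by simp)] at hle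
    have h2 := ENNReal.toReal_mono (by finiteness) hle
    rw [ENNReal.toReal_mul, ENNReal.toReal_ofReal hpos.le] at h2
    simpa [dist_eq_norm] using h2
  have hlim : Filter.Tendsto (fun y ↦ (K : ℝ) * ω (dist y x)) (nhds x) (nhds 0) := by
    have hw : Filter.Tendsto ω (nhdsWithin 0 (Set.Icc 0 1)) (nhds 0) := by
      have := hω.continuousOn 0 (by simp)
      rwa [ContinuousWithinAt, hω.map_zero] at this
    have hd : Filter.Tendsto (fun y ↦ dist y x) (nhds x) (nhdsWithin 0 (Set.Icc 0 1)) := by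
      refine tendsto_nhdsWithin_iff.mpr ⟨?_, ?_⟩
      · have : Continuous fun y ↦ dist y x := by fun_prop
        simpa using this.tendsto x
      · filter_upwards [Metric.ball_mem_nhds x one_pos] with y hy
        exact ⟨dist_nonneg, (Metric.mem_ball.mp hy).le⟩
    simpa using (hw.comp hd).const_mul (K : ℝ)
  refine tendsto_iff_dist_tendsto_zero.mpr ?_
  refine squeeze_zero' (Filter.Eventually.of_forall fun _ ↦ dist_nonneg) ?_ hlim
  filter_upwards [Metric.ball_mem_nhds x one_pos] with y hy using key y hy

theorem MemC.memLp {n : ℕ} {ω : ℝ → ℝ} (hω : IsModulus ω) {a : Rn n → ℂ}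
    (ha : MemC ω a) : MemLp a ∞ (volume : Measure (Rn n)) := by
  obtain ⟨M, hM⟩ := ha.bounded
  exact memLp_top_of_bound (ha.continuous hω).aestronglyMeasurable M (.of_forall hM)

/-- The tempered distribution `g ↦ ∫ a g` defined by an essentially bounded function. -/
def ofBounded {n : ℕ} (a : Rn n → ℂ) (ha : MemLp a ∞ (volume : Measure (Rn n))) :
    𝓢'(Rn n, ℂ) :=
  Lp.toTemperedDistribution (ha.toLp a)

/-! ### Littlewood-Paley decomposition -/

/-- The cut-offs `χ`, `φ` of a dyadic partition of unity: smooth functions with values in `[0,1]`,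
`supp χ ⊆ {|ξ| ≤ 4/3}`, `supp φ ⊆ {3/4 ≤ |ξ| ≤ 8/3}`, and `χ(ξ) + ∑_{q ≥ 0} φ(2^{-q} ξ) = 1`
(so that `φ(ξ) = χ(ξ/2) - χ(ξ)`). -/
structure IsDyadicPartition {n : ℕ} (χ φ : Rn n → ℝ) : Prop where
  contDiff_chi : ContDiff ℝ (⊤ : ℕ∞) χ
  contDiff_phi : ContDiff ℝ (⊤ : ℕ∞) φ
  chi_mem : ∀ ξ, χ ξ ∈ Set.Icc (0 : ℝ) 1
  phi_mem : ∀ ξ, φ ξ ∈ Set.Icc (0 : ℝ) 1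
  tsupport_chi : tsupport χ ⊆ {ξ | ‖ξ‖ ≤ 4 / 3}
  tsupport_phi : tsupport φ ⊆ {ξ | 3 / 4 ≤ ‖ξ‖ ∧ ‖ξ‖ ≤ 8 / 3}
  hasSum : ∀ ξ, HasSum (fun q : ℕ ↦ φ ((2 : ℝ) ^ (-(q : ℤ)) • ξ)) (1 - χ ξ)

/-- The operator `m(2^{-q} D)`, `D = -i∂`, on tempered distributions. The Fourier transform here has
the kernel `e^{-2πi x·ξ}`, so `D` is the multiplier by `2πξ`. -/
def dyadicMultiplier {n : ℕ} (m : Rn n → ℝ) (q : ℤ) : 𝓢'(Rn n, ℂ) →L[ℂ] 𝓢'(Rn n, ℂ) :=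
  fourierMultiplierCLM ℂ fun ξ : Rn n ↦ ((m ((2 : ℝ) ^ (-q) • (2 * Real.pi) • ξ) : ℝ) : ℂ)

/-- The dyadic blocks: `Δ_q = 0` for `q ≤ -2`, `Δ_{-1} = χ(D)`, `Δ_q = φ(2^{-q}D)` for `q ≥ 0`. -/
def Delta {n : ℕ} (χ φ : Rn n → ℝ) (q : ℤ) : 𝓢'(Rn n, ℂ) →L[ℂ] 𝓢'(Rn n, ℂ) :=
  if q ≤ -2 then 0 else if q = -1 then dyadicMultiplier χ 0 else dyadicMultiplier φ q

/-- The low frequency cut-offs `S_q = χ(2^{-q}D)` for `q ≥ 0`. For `q < 0` one has `S_q = 0`, in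
accordance with `S_q = ∑_{p ≤ q-1} Δ_p`. -/
def S {n : ℕ} (χ : Rn n → ℝ) (q : ℤ) : 𝓢'(Rn n, ℂ) →L[ℂ] 𝓢'(Rn n, ℂ) :=
  if 0 ≤ q then dyadicMultiplier χ q else 0

/-! ### Norms -/

/-- The `L²` norm of a tempered distribution; it is `∞` if the distribution is not in `L²`. -/
def L2norm {n : ℕ} (u : 𝓢'(Rn n, ℂ)) : ℝ≥0∞ :=
  ⨅ (f : Lp ℂ 2 (volume : Measure (Rn n))) (_ : Lp.toTemperedDistribution f = u), ‖f‖ₑ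

/-- `(∑_{q ≥ -1} 2^{2σq} ‖u_q‖²_{L²})^{1/2}` for a sequence of tempered distributions `u_q`. -/
def dyadicNorm {n : ℕ} (σ : ℝ) (u : ℤ → 𝓢'(Rn n, ℂ)) : ℝ≥0∞ :=
  (∑' q : Set.Ici (-1 : ℤ), (2 : ℝ≥0∞) ^ (2 * σ * ((q : ℤ) : ℝ)) * L2norm (u q) ^ 2) ^ (1 / 2 : ℝ)

/-- `‖u‖_{H^s_Ω} = (∑_{q ≥ -1} 2^{2sq} Ω(q)² ‖Δ_q u‖²_{L²})^{1/2}`. -/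
def normH {n : ℕ} (χ φ : Rn n → ℝ) (ω : ℝ → ℝ) (s : ℝ) (u : 𝓢'(Rn n, ℂ)) : ℝ≥0∞ :=
  (∑' q : Set.Ici (-1 : ℤ), (2 : ℝ≥0∞) ^ (2 * s * ((q : ℤ) : ℝ)) *
    ENNReal.ofReal (Omega ω q) ^ 2 * L2norm (Delta χ φ q u) ^ 2) ^ (1 / 2 : ℝ)

/-- `u ∈ H^s_Ω(ℝⁿ)`. -/
def MemH {n : ℕ} (χ φ : Rn n → ℝ) (ω : ℝ → ℝ) (s : ℝ) (u : 𝓢'(Rn n, ℂ)) : Prop :=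
  normH χ φ ω s u < ∞

/-! ### Paradifferential remainders -/

open Classical in
/-- The smooth function of temperate growth that represents the tempered distribution `u`
(unique if it exists; it exists whenever `𝓕 u` has compact support). -/
def smoothRep {n : ℕ} (u : 𝓢'(Rn n, ℂ)) : Rn n → ℂ :=
  if h : ∃ f : Rn n → ℂ, ∃ hf : f.HasTemperateGrowth, hf.toTemperedDistribution = u
  then h.choose else 0

/-- The product `u v` of tempered distributions, the first of which is a smooth function of
temperate growth. -/
def mul {n : ℕ} (u v : 𝓢'(Rn n, ℂ)) : 𝓢'(Rn n, ℂ) := smulLeftCLM ℂ (smoothRep u) v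

variable {n : ℕ} (χ φ : Rn n → ℝ) (a b : 𝓢'(Rn n, ℂ)) (q : ℤ)

/-- `R_q^{(1)}(a,b) = ∑_{|q'-q| ≤ 4} [Δ_q, S_{q'-1}a] Δ_{q'}b`, where
`[Δ_q, f] w = Δ_q (f w) - f Δ_q w`. -/
def R1 : 𝓢'(Rn n, ℂ) :=
  ∑ q' ∈ Finset.Icc (q - 4) (q + 4),
    (Delta χ φ q (mul (S χ (q' - 1) a) (Delta χ φ q' b)) -
      mul (S χ (q' - 1) a) (Delta χ φ q (Delta χ φ q' b)))

/-- `R_q^{(2)}(a,b) = ∑_{|q'-q| ≤ 4} (S_{q'-1}a - S_{q-1}a) Δ_q Δ_{q'}b`. -/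
def R2 : 𝓢'(Rn n, ℂ) :=
  ∑ q' ∈ Finset.Icc (q - 4) (q + 4),
    mul (S χ (q' - 1) a - S χ (q - 1) a) (Delta χ φ q (Delta χ φ q' b))

/-- The terms `Δ_q (S_{q'+2}b Δ_{q'}a)` of `R_q^{(3)}(a,b)`. -/
def R3term (q' : ℤ) : 𝓢'(Rn n, ℂ) :=
  Delta χ φ q (mul (S χ (q' + 2) b) (Delta χ φ q' a))

/-- `R_q^{(3)}(a,b) = ∑_{q' > q-4} Δ_q (S_{q'+2}b Δ_{q'}a)`, a series in the space of tempered
distributions. -/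
def R3 : 𝓢'(Rn n, ℂ) := ∑' q' : Set.Ioi (q - 4), R3term χ φ a b q q'

end Paradiff

end

/-! Each block `Delta` and each cut-off `S` averages its argument over translates at scale 2^{-q},
against one of finitely many fixed Schwartz kernels, so constants uniform in q come from integrals
of those kernels. Concavity and ω(0) = 0 give ω(ct) ≤ (1 + c) ω(t), with ω extended by ω(1) beyond
1. Hence |a(x - lz) - a(x)| ≲ ‖a‖ ω(l) (1 + |z|) for a in C^ω. Integrating this against a kernel of
mean one, a kernel of mean zero, or the difference of two translates of a kernel yields S_p a - a =
O(ω(2^{-p})), Δ_q a = O(ω(2^{-q})), and a Lipschitz constant O(2^p ω(2^{-p})) for S_p a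
(`exists_S_bounds`, `exists_Delta_bounds`).

For R1, a commutator with Δ_q gains 2^{-q} times the Lipschitz constant of the multiplier. For R2,
both cut-offs of a are within O(ω(2^{-q})) of a. Either way the q-th remainder is at most ω(2^{-q})
times the L² norms of nine blocks of b. Since 2^{(1-s)q} ω(2^{-q}) = 2^{-sq} Ω(q) is the weight of
H^{-s}_Ω, and it changes by a bounded factor between neighbouring indices, the bound follows
(`exists_dyadicNorm_le_of_local`).

For R3, the term with index q' is at most ω(2^{-q'}) ∑_{p ≤ q'+1} ‖Δ_p b‖. The quotient condition
splits ω(2^{-q'}) into ω(2^{-(q'-p)}) ω(2^{-p}), and the powers of 2 split accordingly. What remains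
is a double discrete convolution of the weighted norms of Δ_p b with two sequences: 2^{(1-s)i} for i
< 4, summable because s < 1, and 2^{(1-s)j} ω(2^{-j}) for j ≥ -1, summable by the series condition.
Young's inequality ℓ¹ * ℓ² → ℓ², used twice, gives the estimate. It also shows that the series
converges absolutely in L², hence unconditionally as tempered distributions (`exists_R3_le`). -/

noncomputable section

namespace Paradiff

/-! ### Functions of tempered size and the distributions they represent -/

section Tempered

variable {E : Type*} [NormedAddCommGroup E] [InnerProductSpace ℝ E] [FiniteDimensional ℝ E]
  [MeasurableSpace E] [BorelSpace E]

/-- Measurable functions that are integrable against some negative power of `1 + ‖x‖`. -/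
structure IsTempered (f : E → ℂ) : Prop where
  aestronglyMeasurable : AEStronglyMeasurable f volume
  exists_integrable : ∃ N : ℕ, Integrable fun x ↦ ((1 + ‖x‖) ^ N)⁻¹ * ‖f x‖

theorem integrable_weight_mono {f : E → ℂ} (hf : AEStronglyMeasurable f volume) {N M : ℕ}
    (hNM : N ≤ M) (h : Integrable fun x ↦ ((1 + ‖x‖) ^ N)⁻¹ * ‖f x‖) :
    Integrable fun x ↦ ((1 + ‖x‖) ^ M)⁻¹ * ‖f x‖ := by
  refine h.mono' ?_ (.of_forall fun x ↦ ?_)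
  · refine AEStronglyMeasurable.mul (Continuous.aestronglyMeasurable ?_) hf.norm
    exact Continuous.inv₀ (by fun_prop) fun x ↦ by positivity
  · rw [Real.norm_of_nonneg (by positivity)]
    gcongr
    simp

theorem IsTempered.integrable_mul_of_le {f : E → ℂ} {N : ℕ}
    (hf : AEStronglyMeasurable f volume) (h : Integrable fun x ↦ ((1 + ‖x‖) ^ N)⁻¹ * ‖f x‖)
    {G : Type*} [NormedAddCommGroup G] [NormedSpace ℂ G]
    {k : E → G} (hk : AEStronglyMeasurable k volume) {C : ℝ}
    (hC : ∀ x, ‖k x‖ ≤ C * ((1 + ‖x‖) ^ N)⁻¹) : Integrable fun x ↦ f x • k x := by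
  refine (h.const_mul C).mono' (hf.smul hk) (.of_forall fun x ↦ ?_)
  rw [norm_smul]
  calc ‖f x‖ * ‖k x‖ ≤ ‖f x‖ * (C * ((1 + ‖x‖) ^ N)⁻¹) := by gcongr; exact hC x
    _ = _ := by ring

theorem schwartz_decay {V G : Type*} [NormedAddCommGroup V] [NormedSpace ℝ V]
    [NormedAddCommGroup G] [NormedSpace ℝ G] (k : 𝓢(V, G)) (N : ℕ) :
    ∃ C : ℝ, 0 ≤ C ∧ ∀ x, ‖k x‖ ≤ C * ((1 + ‖x‖) ^ N)⁻¹ := by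
  refine ⟨2 ^ N * ((Finset.Iic (N, 0)).sup (fun m ↦ SchwartzMap.seminorm ℝ m.1 m.2) k), ?_,
    fun x ↦ ?_⟩
  · exact mul_nonneg (by positivity) (apply_nonneg _ _)
  · have := SchwartzMap.one_add_le_sup_seminorm_apply (𝕜 := ℝ) (m := (N, 0)) le_rfl le_rfl k x
    rw [← div_eq_mul_inv, le_div_iff₀ (by positivity), mul_comm]
    simpa using this

theorem IsTempered.integrable_smul_schwartz {f : E → ℂ} (hf : IsTempered f)
    {G : Type*} [NormedAddCommGroup G] [NormedSpace ℂ G] (k : 𝓢(E, G)) :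
    Integrable fun x ↦ f x • k x := by
  obtain ⟨N, hN⟩ := hf.exists_integrable
  obtain ⟨C, -, hC⟩ := schwartz_decay k N
  exact IsTempered.integrable_mul_of_le hf.aestronglyMeasurable hN
    k.continuous.aestronglyMeasurable hC

theorem IsTempered.congr {f g : E → ℂ} (hf : IsTempered f) (h : f =ᵐ[volume] g) :
    IsTempered g := by
  obtain ⟨N, hN⟩ := hf.exists_integrable
  refine ⟨hf.aestronglyMeasurable.congr h, N, hN.congr ?_⟩
  filter_upwards [h] with x hx
  rw [hx]

theorem IsTempered.add {f g : E → ℂ} (hf : IsTempered f) (hg : IsTempered g) :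
    IsTempered (f + g) := by
  obtain ⟨N, hN⟩ := hf.exists_integrable
  obtain ⟨M, hM⟩ := hg.exists_integrable
  have hfg := hf.aestronglyMeasurable.add hg.aestronglyMeasurable
  refine ⟨hfg, max N M, ?_⟩
  refine ((integrable_weight_mono hf.aestronglyMeasurable (le_max_left N M) hN).add
    (integrable_weight_mono hg.aestronglyMeasurable (le_max_right N M) hM)).mono' ?_
    (.of_forall fun x ↦ ?_)
  · refine AEStronglyMeasurable.mul (Continuous.aestronglyMeasurable ?_) hfg.norm
    exact Continuous.inv₀ (by fun_prop) fun x ↦ by positivity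
  · rw [Real.norm_of_nonneg (by positivity)]
    simp only [Pi.add_apply, ← mul_add]
    gcongr
    exact norm_add_le _ _

theorem IsTempered.neg {f : E → ℂ} (hf : IsTempered f) : IsTempered (-f) := by
  obtain ⟨N, hN⟩ := hf.exists_integrable
  exact ⟨hf.aestronglyMeasurable.neg, N, by simpa using hN⟩

theorem IsTempered.zero : IsTempered (0 : E → ℂ) := ⟨aestronglyMeasurable_zero, 0, by simp⟩

theorem IsTempered.bound_mul {F f : E → ℂ} (hF : AEStronglyMeasurable F volume) {C : ℝ} {k : ℕ}
    (hC : ∀ x, ‖F x‖ ≤ C * (1 + ‖x‖) ^ k) (hf : IsTempered f) :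
    IsTempered fun x ↦ F x * f x := by
  obtain ⟨N, hN⟩ := hf.exists_integrable
  have hFf := hF.mul hf.aestronglyMeasurable
  refine ⟨hFf, N + k, (hN.const_mul C).mono' ?_ (.of_forall fun x ↦ ?_)⟩
  · refine AEStronglyMeasurable.mul (Continuous.aestronglyMeasurable ?_) hFf.norm
    exact Continuous.inv₀ (by fun_prop) fun x ↦ by positivity
  · rw [Real.norm_of_nonneg (by positivity), norm_mul]
    calc ((1 + ‖x‖) ^ (N + k))⁻¹ * (‖F x‖ * ‖f x‖)
        ≤ ((1 + ‖x‖) ^ (N + k))⁻¹ * ((C * (1 + ‖x‖) ^ k) * ‖f x‖) := by gcongr; exact hC x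
      _ = C * (((1 + ‖x‖) ^ N)⁻¹ * ‖f x‖) := by
        rw [pow_add]
        field_simp

theorem IsTempered.one : IsTempered (fun _ : E ↦ (1 : ℂ)) := by
  refine ⟨aestronglyMeasurable_const, (volume : Measure E).integrablePower, ?_⟩
  simpa using Measure.integrable_pow_neg_integrablePower (volume : Measure E)

theorem IsTempered.of_hasTemperateGrowth {f : E → ℂ} (hf : f.HasTemperateGrowth) :
    IsTempered f := by
  obtain ⟨k, C, hC⟩ := hf.2 0
  simpa using IsTempered.bound_mul (F := f) hf.1.continuous.aestronglyMeasurable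
    (by simpa using hC) IsTempered.one

/-- Hölder: a high enough negative power of 1 + ‖x‖ lies in the conjugate Lebesgue space. This puts
L² blocks of b and bounded a in one class. -/
theorem IsTempered.of_memLp {f : E → ℂ} {p : ℝ≥0∞} (hp : 1 ≤ p) (hf : MemLp f p volume) :
    IsTempered f := by
  have hpq : ENNReal.HolderConjugate p (1 - p⁻¹)⁻¹ := ENNReal.HolderConjugate.inv_one_sub_inv' hp
  obtain ⟨k, hk⟩ := Measure.HasTemperateGrowth.exists_eLpNorm_lt_top (E := E) (1 - p⁻¹)⁻¹
    (μ := volume) inferInstance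
  refine ⟨hf.aestronglyMeasurable, k, ?_⟩
  have hk' : MemLp (fun x : E ↦ ((1 + ‖x‖) ^ k)⁻¹) (1 - p⁻¹)⁻¹ volume := by
    refine ⟨Continuous.aestronglyMeasurable
      (Continuous.inv₀ (by fun_prop) fun x ↦ by positivity), ?_⟩
    convert! hk using 2
    ext x
    rw [Real.rpow_neg (by positivity), Real.rpow_natCast]
  exact hk'.integrable_mul hf.norm (p := (1 - p⁻¹)⁻¹) (q := p)

theorem IsTempered.locallyIntegrable {f : E → ℂ} (hf : IsTempered f) :
    LocallyIntegrable f volume := by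
  obtain ⟨N, hN⟩ := hf.exists_integrable
  have hN' : Integrable (fun x ↦ ((((1 + ‖x‖) ^ N)⁻¹ : ℝ) • f x)) := by
    refine hN.mono' ?_ (.of_forall fun x ↦ ?_)
    · have : Continuous fun x : E ↦ ((1 + ‖x‖) ^ N)⁻¹ :=
        Continuous.inv₀ (by fun_prop) fun x ↦ by positivity
      exact this.aestronglyMeasurable.smul hf.aestronglyMeasurable
    · rw [norm_smul, Real.norm_of_nonneg (by positivity)]
  have := (locallyIntegrableOn_univ.2 hN'.locallyIntegrable).continuousOn_smul
    (g := fun x : E ↦ ((1 + ‖x‖) ^ N : ℝ)) isOpen_univ.isLocallyClosed (by fun_prop)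
  rw [locallyIntegrableOn_univ] at this
  convert! this using 1
  ext x
  rw [smul_smul, mul_inv_cancel₀ (by positivity), one_smul]

/-- The tempered distribution `u` is given by integration against the function `f`. -/
structure IsRep (u : 𝓢'(E, ℂ)) (f : E → ℂ) : Prop where
  isTempered : IsTempered f
  apply_eq : ∀ g : 𝓢(E, ℂ), u g = ∫ x, g x * f x

theorem IsTempered.integrable_schwartz_mul {f : E → ℂ} (hf : IsTempered f) (g : 𝓢(E, ℂ)) :
    Integrable fun x ↦ g x * f x := by
  simpa [mul_comm] using hf.integrable_smul_schwartz g

theorem IsRep.congr {u : 𝓢'(E, ℂ)} {f g : E → ℂ} (hf : IsRep u f) (h : f =ᵐ[volume] g) :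
    IsRep u g := by
  refine ⟨hf.isTempered.congr h, fun k ↦ ?_⟩
  rw [hf.apply_eq]
  refine integral_congr_ae ?_
  filter_upwards [h] with x hx
  rw [hx]

theorem IsRep.zero : IsRep (0 : 𝓢'(E, ℂ)) 0 := ⟨.zero, fun g ↦ by simp⟩

theorem IsRep.add {u v : 𝓢'(E, ℂ)} {f g : E → ℂ} (hf : IsRep u f) (hg : IsRep v g) :
    IsRep (u + v) (f + g) := by
  refine ⟨hf.isTempered.add hg.isTempered, fun k ↦ ?_⟩
  rw [_root_.add_apply, hf.apply_eq, hg.apply_eq, ← integral_add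
    (hf.isTempered.integrable_schwartz_mul k) (hg.isTempered.integrable_schwartz_mul k)]
  simp [mul_add]

theorem IsRep.neg {u : 𝓢'(E, ℂ)} {f : E → ℂ} (hf : IsRep u f) : IsRep (-u) (-f) := by
  refine ⟨hf.isTempered.neg, fun k ↦ ?_⟩
  simp [hf.apply_eq, integral_neg]

theorem IsRep.sub {u v : 𝓢'(E, ℂ)} {f g : E → ℂ} (hf : IsRep u f) (hg : IsRep v g) :
    IsRep (u - v) (f - g) := by
  rw [sub_eq_add_neg, sub_eq_add_neg]
  exact hf.add hg.neg

/-- Smooth compactly supported real functions are Schwartz functions and already separate locally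
integrable functions. -/
theorem IsRep.ae_eq {u : 𝓢'(E, ℂ)} {f g : E → ℂ} (hf : IsRep u f) (hg : IsRep u g) :
    f =ᵐ[volume] g := by
  refine ae_eq_of_integral_contDiff_smul_eq hf.isTempered.locallyIntegrable
    hg.isTempered.locallyIntegrable fun k hk hk' ↦ ?_
  have h₁ : HasCompactSupport (Complex.ofRealCLM ∘ k) := hk'.comp_left rfl
  have h₂ : ContDiff ℝ (⊤ : ℕ∞) (Complex.ofRealCLM ∘ k) := Complex.ofRealCLM.contDiff.comp hk
  simpa using (hf.apply_eq (h₁.toSchwartzMap h₂)).symm.trans (hg.apply_eq (h₁.toSchwartzMap h₂))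

theorem IsRep.lp {p : ℝ≥0∞} [hp : Fact (1 ≤ p)] (f : Lp ℂ p (volume : Measure E)) :
    IsRep (Lp.toTemperedDistribution f) f :=
  ⟨.of_memLp hp.out (Lp.memLp f), fun g ↦ by simp⟩

theorem IsRep.toLp {u : 𝓢'(E, ℂ)} {f : E → ℂ} (hu : IsRep u f) {p : ℝ≥0∞} [hp : Fact (1 ≤ p)]
    (hf : MemLp f p volume) : Lp.toTemperedDistribution (hf.toLp f) = u := by
  ext g
  have := IsRep.congr (IsRep.lp (hf.toLp f)) hf.coeFn_toLp
  rw [this.apply_eq, hu.apply_eq]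

theorem IsRep.toTemperedDistribution {f : E → ℂ} (hf : f.HasTemperateGrowth) :
    IsRep (hf.toTemperedDistribution) f :=
  ⟨.of_hasTemperateGrowth hf, fun g ↦ by simp⟩

theorem IsRep.smulLeftCLM {v : 𝓢'(E, ℂ)} {f g : E → ℂ} (hf : f.HasTemperateGrowth)
    (hg : IsRep v g) : IsRep (smulLeftCLM ℂ f v) (fun x ↦ f x * g x) := by
  obtain ⟨k, C, hC⟩ := hf.2 0
  refine ⟨hg.isTempered.bound_mul hf.1.continuous.aestronglyMeasurable (by simpa using hC),
    fun h ↦ ?_⟩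
  rw [TemperedDistribution.smulLeftCLM_apply_apply, hg.apply_eq]
  congr with x
  rw [SchwartzMap.smulLeftCLM_apply_apply hf, smul_eq_mul]
  ring

end Tempered

/-! ### Products and L² norms computed on representatives -/

section Products

variable {n : ℕ}

/-- Continuous functions that agree almost everywhere are equal, so the choice inside `smoothRep` is
forced. -/
theorem smoothRep_eq {u : 𝓢'(Rn n, ℂ)} {f : Rn n → ℂ} (hf : f.HasTemperateGrowth)
    (hu : IsRep u f) : smoothRep u = f := by
  have h : ∃ f : Rn n → ℂ, ∃ hf : f.HasTemperateGrowth, hf.toTemperedDistribution = u := by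
    refine ⟨f, hf, ?_⟩
    ext g
    rw [(IsRep.toTemperedDistribution hf).apply_eq, hu.apply_eq]
  obtain ⟨h₁, h₂⟩ := h.choose_spec
  rw [smoothRep, dif_pos h]
  have h₃ := IsRep.toTemperedDistribution h₁
  rw [h₂] at h₃
  exact (h₁.1.continuous.ae_eq_iff_eq volume hf.1.continuous).1 (h₃.ae_eq hu)

theorem IsRep.mul {u v : 𝓢'(Rn n, ℂ)} {f g : Rn n → ℂ} (hf : f.HasTemperateGrowth)
    (hu : IsRep u f) (hv : IsRep v g) : IsRep (mul u v) (fun x ↦ f x * g x) := by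
  rw [Paradiff.mul, smoothRep_eq hf hu]
  exact hv.smulLeftCLM hf

theorem IsRep.L2norm_le {u : 𝓢'(Rn n, ℂ)} {f : Rn n → ℂ} (hu : IsRep u f) :
    L2norm u ≤ eLpNorm f 2 volume := by
  by_cases h : eLpNorm f 2 volume = ∞
  · simp [h]
  have hf : MemLp f 2 volume := ⟨hu.isTempered.aestronglyMeasurable, lt_top_iff_ne_top.2 h⟩
  refine (iInf₂_le (hf.toLp f) (hu.toLp hf)).trans ?_
  rw [Lp.enorm_def, eLpNorm_congr_ae hf.coeFn_toLp]

theorem exists_isRep_of_L2norm_lt_top {u : 𝓢'(Rn n, ℂ)} (hu : L2norm u < ∞) :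
    ∃ f : Lp ℂ 2 (volume : Measure (Rn n)), Lp.toTemperedDistribution f = u ∧ ‖f‖ₑ = L2norm u := by
  have h₁ : ∃ f : Lp ℂ 2 (volume : Measure (Rn n)), Lp.toTemperedDistribution f = u := by
    by_contra! h
    simp [L2norm, h] at hu
  obtain ⟨f, hf⟩ := h₁
  refine ⟨f, hf, le_antisymm (le_iInf₂ fun g hg ↦ ?_) (iInf₂_le f hf)⟩
  have hf' := IsRep.lp f
  have hg' := IsRep.lp g
  rw [hf] at hf'
  rw [hg] at hg'
  rw [Lp.enorm_def, Lp.enorm_def, eLpNorm_congr_ae (hf'.ae_eq hg')]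

theorem exists_memLp_of_L2norm_lt_top {u : 𝓢'(Rn n, ℂ)} (hu : L2norm u < ∞) :
    ∃ f : Rn n → ℂ, IsRep u f ∧ Measurable f ∧ eLpNorm f 2 volume = L2norm u := by
  obtain ⟨f, rfl, hf⟩ := exists_isRep_of_L2norm_lt_top hu
  exact ⟨f, .lp f, (Lp.stronglyMeasurable f).measurable, by rw [← hf, Lp.enorm_def]⟩

end Products

/-! ### Convolution with Schwartz kernels and Fourier multipliers -/

section Convolution

variable {E : Type} [NormedAddCommGroup E] [InnerProductSpace ℝ E] [FiniteDimensional ℝ E]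
  [MeasurableSpace E] [BorelSpace E]

/-- The convolution of a function with a Schwartz function. -/
def schwartzConv {G : Type} [NormedAddCommGroup G] [NormedSpace ℝ G] [NormedSpace ℂ G]
    (k : 𝓢(E, G)) (f : E → ℂ) (x : E) : G := ∫ y, f y • k (x - y)

/-- Peetre's inequality. It separates the variables of a translated kernel, which is what
differentiation under the integral and Fubini need. -/
theorem one_add_norm_sub_pow_inv_le {V : Type*} [NormedAddCommGroup V] (x y : V) (N : ℕ) :
    ((1 + ‖x - y‖) ^ N)⁻¹ ≤ (1 + ‖x‖) ^ N * ((1 + ‖y‖) ^ N)⁻¹ := by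
  rw [← div_eq_mul_inv, inv_eq_one_div, div_le_div_iff₀ (by positivity) (by positivity), one_mul,
    ← mul_pow]
  gcongr
  have h : ‖y‖ ≤ ‖x‖ + ‖x - y‖ := by
    have := norm_sub_le x (x - y)
    simpa using this
  nlinarith [norm_nonneg x, norm_nonneg (x - y)]

theorem exists_norm_comp_sub_le {V G : Type*} [NormedAddCommGroup V] [NormedSpace ℝ V]
    [NormedAddCommGroup G] [NormedSpace ℝ G] (k : 𝓢(V, G)) (N : ℕ) :
    ∃ C : ℝ, 0 ≤ C ∧ ∀ x y, ‖k (x - y)‖ ≤ C * (1 + ‖x‖) ^ N * ((1 + ‖y‖) ^ N)⁻¹ := by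
  obtain ⟨C, hC₀, hC⟩ := schwartz_decay k N
  refine ⟨C, hC₀, fun x y ↦ (hC _).trans ?_⟩
  rw [mul_assoc]
  gcongr
  exact one_add_norm_sub_pow_inv_le x y N

section

variable {G : Type} [NormedAddCommGroup G] [NormedSpace ℝ G] [NormedSpace ℂ G]

theorem IsTempered.integrable_conv {f : E → ℂ} (hf : IsTempered f) (k : 𝓢(E, G)) (x : E) :
    Integrable fun y ↦ f y • k (x - y) := by
  obtain ⟨N, hN⟩ := hf.exists_integrable
  obtain ⟨C, -, hC⟩ := exists_norm_comp_sub_le k N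
  exact IsTempered.integrable_mul_of_le hf.aestronglyMeasurable hN
    (k.continuous.comp (by fun_prop)).aestronglyMeasurable (hC x)

theorem IsTempered.exists_norm_schwartzConv_le {f : E → ℂ} (hf : IsTempered f) (k : 𝓢(E, G)) :
    ∃ (N : ℕ) (C : ℝ), ∀ x, ‖schwartzConv k f x‖ ≤ C * (1 + ‖x‖) ^ N := by
  obtain ⟨N, hN⟩ := hf.exists_integrable
  obtain ⟨C, -, hC⟩ := exists_norm_comp_sub_le k N
  refine ⟨N, C * ∫ y, ((1 + ‖y‖) ^ N)⁻¹ * ‖f y‖, fun x ↦ ?_⟩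
  rw [mul_right_comm, ← integral_const_mul]
  refine norm_integral_le_of_norm_le (hN.const_mul _) (.of_forall fun y ↦ ?_)
  rw [norm_smul]
  calc ‖f y‖ * ‖k (x - y)‖ ≤ ‖f y‖ * (C * (1 + ‖x‖) ^ N * ((1 + ‖y‖) ^ N)⁻¹) := by
        gcongr; exact hC x y
    _ = _ := by ring

variable [SMulCommClass ℝ ℂ G]

theorem IsTempered.hasFDerivAt_schwartzConv {f : E → ℂ} (hf : IsTempered f) (k : 𝓢(E, G))
    (x : E) :
    HasFDerivAt (schwartzConv k f) (schwartzConv (fderivCLM ℝ E G k) f x) x := by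
  obtain ⟨N, hN⟩ := hf.exists_integrable
  obtain ⟨C, hC₀, hC⟩ := exists_norm_comp_sub_le (fderivCLM ℝ E G k) N
  refine hasFDerivAt_integral_of_dominated_of_fderiv_le (𝕜 := ℝ)
    (bound := fun y ↦ C * (1 + (‖x‖ + 1)) ^ N * (((1 + ‖y‖) ^ N)⁻¹ * ‖f y‖))
    (F' := fun x y ↦ f y • fderivCLM ℝ E G k (x - y))
    (Metric.ball_mem_nhds x one_pos) (.of_forall fun x ↦ ?_) (hf.integrable_conv k x)
    (hf.integrable_conv (fderivCLM ℝ E G k) x).aestronglyMeasurable ?_ (hN.const_mul _) ?_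
  · exact (hf.integrable_conv k x).aestronglyMeasurable
  · refine .of_forall fun y x' hx' ↦ ?_
    have : ‖x'‖ ≤ ‖x‖ + 1 := by
      have h₁ := norm_sub_norm_le x' x
      have h₂ := mem_ball_iff_norm.1 hx'
      linarith
    rw [norm_smul]
    calc ‖f y‖ * ‖fderivCLM ℝ E G k (x' - y)‖
        ≤ ‖f y‖ * (C * (1 + ‖x'‖) ^ N * ((1 + ‖y‖) ^ N)⁻¹) := by gcongr; exact hC x' y
      _ ≤ ‖f y‖ * (C * (1 + (‖x‖ + 1)) ^ N * ((1 + ‖y‖) ^ N)⁻¹) := by gcongr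
      _ = _ := by ring
  · refine .of_forall fun y x' _ ↦ ?_
    have h : HasFDerivAt k (fderiv ℝ k (x' - y)) (x' - y) := k.hasFDerivAt _
    exact (h.comp x' ((hasFDerivAt_id x').sub_const y)).const_smul (f y)

end

/-- Derivatives fall on the kernel. The target space is quantified inside the induction because the
differentiated kernel takes values in linear maps. -/
theorem IsTempered.hasTemperateGrowth_schwartzConv_aux {f : E → ℂ} (hf : IsTempered f) (m : ℕ) :
    ∀ {G : Type} [NormedAddCommGroup G] [NormedSpace ℝ G] [NormedSpace ℂ G] [SMulCommClass ℝ ℂ G]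
      (k : 𝓢(E, G)), ContDiff ℝ m (schwartzConv k f) ∧
      ∃ (N : ℕ) (C : ℝ), ∀ x, ‖iteratedFDeriv ℝ m (schwartzConv k f) x‖ ≤ C * (1 + ‖x‖) ^ N := by
  induction m with
  | zero =>
    intro G _ _ _ _ k
    refine ⟨?_, ?_⟩
    · rw [Nat.cast_zero, contDiff_zero]
      exact continuous_iff_continuousAt.2 fun x ↦ (hf.hasFDerivAt_schwartzConv k x).continuousAt
    · simpa using hf.exists_norm_schwartzConv_le k
  | succ m ih =>
    intro G _ _ _ _ k
    have hd : fderiv ℝ (schwartzConv k f) = schwartzConv (fderivCLM ℝ E G k) f :=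
      funext fun x ↦ (hf.hasFDerivAt_schwartzConv k x).fderiv
    obtain ⟨h₁, N, C, h₂⟩ := ih (fderivCLM ℝ E G k)
    refine ⟨?_, N, C, fun x ↦ ?_⟩
    · rw [Nat.cast_succ, contDiff_succ_iff_fderiv, hd]
      exact ⟨fun x ↦ (hf.hasFDerivAt_schwartzConv k x).differentiableAt, by simp, h₁⟩
    · rw [← norm_iteratedFDeriv_fderiv, hd]
      exact h₂ x

theorem IsTempered.hasTemperateGrowth_schwartzConv {f : E → ℂ} (hf : IsTempered f)
    (k : 𝓢(E, ℂ)) : (schwartzConv k f).HasTemperateGrowth :=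
  ⟨contDiff_infty.2 fun m ↦ (hf.hasTemperateGrowth_schwartzConv_aux m k).1,
    fun m ↦ (hf.hasTemperateGrowth_schwartzConv_aux m k).2⟩

/-- The average `∫ K(z) f(x - l z) dz`. -/
def avg (K : 𝓢(E, ℂ)) (l : ℝ) (f : E → ℂ) (x : E) : ℂ := ∫ z, K z * f (x - l • z)

/-- The kernel `l⁻ᵈ K(x/l)`. -/
def dilate {V : Type*} [NormedAddCommGroup V] [NormedSpace ℝ V] (K : 𝓢(V, ℂ)) {l : ℝ}
    (hl : 0 < l) : 𝓢(V, ℂ) :=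
  ((l ^ Module.finrank ℝ V)⁻¹ : ℂ) • compCLMOfContinuousLinearEquiv ℂ
    (ContinuousLinearEquiv.smulLeft (Units.mk0 l⁻¹ (inv_ne_zero hl.ne'))) K

theorem dilate_apply {V : Type*} [NormedAddCommGroup V] [NormedSpace ℝ V] (K : 𝓢(V, ℂ)) {l : ℝ}
    (hl : 0 < l) (x : V) :
    dilate K hl x = ((l ^ Module.finrank ℝ V)⁻¹ : ℂ) * K (l⁻¹ • x) := by
  simp [dilate]

theorem integral_dilate_comp_sub (K : 𝓢(E, ℂ)) {l : ℝ} (hl : 0 < l) (f : E → ℂ) (x : E) :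
    ∫ y, dilate K hl (y - x) * f y = ∫ z, K z * f (x + l • z) := by
  have h₁ := integral_sub_right_eq_self (μ := volume)
    (fun y ↦ dilate K hl y * f (x + y)) x
  have h₂ := Measure.integral_comp_inv_smul_of_nonneg volume (fun z ↦ K z * f (x + l • z)) hl.le
  simp only [add_sub_cancel] at h₁
  rw [h₁]
  simp only [dilate_apply, mul_assoc, integral_const_mul]
  simp only [smul_inv_smul₀ hl.ne'] at h₂
  rw [h₂]
  have : (l : ℂ) ^ Module.finrank ℝ E ≠ 0 := pow_ne_zero _ (by exact_mod_cast hl.ne')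
  simp [this]

theorem schwartzConv_dilate (K : 𝓢(E, ℂ)) {l : ℝ} (hl : 0 < l) (f : E → ℂ) :
    schwartzConv (dilate K hl) f = avg K l f := by
  ext x
  have h := integral_dilate_comp_sub K hl (fun z ↦ f (x - z)) 0
  have h₂ := integral_sub_left_eq_self (fun y ↦ dilate K hl y * f (x - y)) volume x
  simp only [sub_sub_cancel] at h₂
  simp only [sub_zero, zero_add] at h
  rw [avg, ← h, ← h₂, schwartzConv]
  congr with y
  rw [smul_eq_mul, mul_comm]

open FourierTransform in
-- Write both M and g by Fourier inversion and exchange the integrals. This is the action of the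
-- multiplier on a test function, in kernel form.
theorem fourier_dilation_mul_fourierInv (M g : 𝓢(E, ℂ)) {l : ℝ} (x : E) :
    ∫ ξ, Real.fourierChar (-inner ℝ ξ x) • (M (l • ξ) * 𝓕⁻ g ξ) =
      ∫ z, 𝓕⁻ M z * g (x + l • z) := by
  have hM : ∀ ξ, M ξ = ∫ z, Real.fourierChar (-inner ℝ z ξ) • 𝓕⁻ M z := fun ξ ↦ by
    rw [← Real.fourier_eq, ← fourier_coe, fourier_fourierInv_eq]
  have hg : ∀ y, g y = ∫ ξ, Real.fourierChar (-inner ℝ ξ y) • 𝓕⁻ g ξ := fun ξ ↦ by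
    rw [← Real.fourier_eq, ← fourier_coe, fourier_fourierInv_eq]
  have h₁ : ∀ ξ, Real.fourierChar (-inner ℝ ξ x) • (M (l • ξ) * 𝓕⁻ g ξ) =
      ∫ z, Real.fourierChar (-inner ℝ ξ (x + l • z)) • (𝓕⁻ M z * 𝓕⁻ g ξ) := fun ξ ↦ by
    rw [hM, ← integral_mul_const, Circle.smul_def, smul_eq_mul, ← integral_const_mul]
    congr with z
    simp only [Circle.smul_def, smul_eq_mul, inner_add_right, neg_add, AddChar.map_add_eq_mul,
      Circle.coe_mul, inner_smul_right, real_inner_comm z]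
    ring
  have h₂ : ∀ z, 𝓕⁻ M z * g (x + l • z) =
      ∫ ξ, Real.fourierChar (-inner ℝ ξ (x + l • z)) • (𝓕⁻ M z * 𝓕⁻ g ξ) := fun z ↦ by
    rw [hg, ← integral_const_mul]
    congr with ξ
    simp only [Circle.smul_def, smul_eq_mul]
    ring
  simp_rw [h₁, h₂]
  refine integral_integral_swap ?_
  have h₃ : Integrable (fun p : E × E ↦ 𝓕⁻ M p.2 * 𝓕⁻ g p.1) (volume.prod volume) := by
    simp_rw [mul_comm (𝓕⁻ M _)]
    exact Integrable.mul_prod ((𝓕⁻ g).integrable (μ := volume)) (𝓕⁻ M).integrable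
  refine h₃.mono ?_ (.of_forall fun p ↦ by simp [Function.uncurry])
  refine AEStronglyMeasurable.smul ?_ h₃.aestronglyMeasurable
  exact (continuous_subtype_val.comp <| Real.continuous_fourierChar.comp (g := Real.fourierChar)
    (f := fun p : E × E ↦ -inner ℝ p.1 (x + l • p.2)) (by fun_prop)).aestronglyMeasurable

open FourierTransform in
-- By duality the multiplier moves to the test function, where it becomes integration against a
-- dilated kernel; Fubini moves that kernel onto f.
theorem IsRep.fourierMultiplier {u : 𝓢'(E, ℂ)} {f : E → ℂ} (hu : IsRep u f) (M : 𝓢(E, ℂ))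
    {l : ℝ} (hl : 0 < l) :
    (avg (𝓕⁻ M) l f).HasTemperateGrowth ∧
      IsRep (fourierMultiplierCLM ℂ (fun ξ ↦ M (l • ξ)) u) (avg (𝓕⁻ M) l f) := by
  have hT : (avg (𝓕⁻ M) l f).HasTemperateGrowth := by
    rw [← schwartzConv_dilate _ hl]
    exact hu.isTempered.hasTemperateGrowth_schwartzConv _
  refine ⟨hT, .of_hasTemperateGrowth hT, fun g ↦ ?_⟩
  have hMl : (fun ξ ↦ M (l • ξ)).HasTemperateGrowth :=
    M.hasTemperateGrowth.comp (l • ContinuousLinearMap.id ℝ E).hasTemperateGrowth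
  set k := dilate (𝓕⁻ M) hl with hk
  have h₁ : ∀ x, 𝓕 (SchwartzMap.smulLeftCLM ℂ (fun ξ ↦ M (l • ξ)) (𝓕⁻ g)) x =
      ∫ y, k (y - x) * g y := fun x ↦ by
    rw [integral_dilate_comp_sub, ← fourier_dilation_mul_fourierInv, fourier_coe, Real.fourier_eq]
    simp_rw [SchwartzMap.smulLeftCLM_apply_apply hMl, smul_eq_mul]
  rw [fourierMultiplierCLM_apply_apply, hu.apply_eq]
  simp_rw [h₁, ← schwartzConv_dilate _ hl, schwartzConv, ← integral_const_mul,
    ← integral_mul_const, ← hk]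
  rw [integral_integral_swap]
  · congr with y
    congr with x
    rw [smul_eq_mul]
    ring
  -- Integrability on the product: Peetre's inequality bounds the kernel by a negative power
  -- absorbed by f and a positive power absorbed by the decay of g.
  obtain ⟨N, hN⟩ := hu.isTempered.exists_integrable
  obtain ⟨C, -, hC⟩ := exists_norm_comp_sub_le k N
  have h₂ : Integrable (fun y ↦ C * ((1 + ‖y‖) ^ N * ‖g y‖)) := by
    refine Integrable.const_mul ?_ C
    obtain ⟨D, -, hD⟩ := schwartz_decay g (N + (volume : Measure E).integrablePower)
    refine ((Measure.integrable_pow_neg_integrablePower (volume : Measure E)).const_mul D).mono'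
      (Continuous.aestronglyMeasurable (by fun_prop)) (.of_forall fun y ↦ ?_)
    rw [Real.norm_of_nonneg (by positivity), Real.rpow_neg (by positivity), Real.rpow_natCast]
    calc _ ≤ (1 + ‖y‖) ^ N * (D * ((1 + ‖y‖) ^ (N + (volume : Measure E).integrablePower))⁻¹) := by
          gcongr; exact hD y
      _ = _ := by rw [pow_add]; field_simp
  refine (hN.mul_prod h₂).mono' ?_ (.of_forall fun p ↦ ?_)
  · refine AEStronglyMeasurable.mul (Continuous.aestronglyMeasurable (by fun_prop)) ?_
    exact hu.isTempered.aestronglyMeasurable.comp_fst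
  · simp only [Function.uncurry, norm_mul]
    calc _ ≤ C * (1 + ‖p.2‖) ^ N * ((1 + ‖p.1‖) ^ N)⁻¹ * ‖g p.2‖ * ‖f p.1‖ := by
          gcongr; exact hC _ _
      _ = _ := by ring

end Convolution

/-- Cauchy-Schwarz with respect to the weight `k`. -/
theorem lintegral_mul_sq_le {α : Type*} [MeasurableSpace α] (μ : Measure α) {k W : α → ℝ≥0∞}
    (hk : Measurable k) (hW : Measurable W) :
    (∫⁻ x, k x * W x ∂μ) ^ 2 ≤ (∫⁻ x, k x ∂μ) * ∫⁻ x, k x * W x ^ 2 ∂μ := by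
  have hh : ∀ t : ℝ≥0∞, (t ^ (1 / 2 : ℝ)) ^ (2 : ℝ) = t := fun t ↦ by
    rw [← ENNReal.rpow_mul]; norm_num
  have h := ENNReal.lintegral_mul_le_Lp_mul_Lq μ Real.HolderConjugate.two_two
    (f := fun x ↦ k x ^ (1 / 2 : ℝ)) (g := fun x ↦ k x ^ (1 / 2 : ℝ) * W x)
    (by fun_prop) (by fun_prop)
  have h₁ : ∀ x, k x ^ (1 / 2 : ℝ) * (k x ^ (1 / 2 : ℝ) * W x) = k x * W x := fun x ↦ by
    rw [← mul_assoc, ← sq, ← ENNReal.rpow_two, hh]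
  simp only [Pi.mul_apply, h₁, hh, ENNReal.mul_rpow_of_nonneg _ _ zero_le_two] at h
  calc _ ≤ ((∫⁻ x, k x ∂μ) ^ (1 / 2 : ℝ) * (∫⁻ x, k x * W x ^ (2 : ℝ) ∂μ) ^ (1 / 2 : ℝ)) ^ 2 := by
        gcongr
    _ = _ := by
        rw [mul_pow, ← ENNReal.rpow_two, ← ENNReal.rpow_two, hh, hh]
        simp_rw [ENNReal.rpow_two]

theorem eLpNorm_two_sq {α : Type*} [MeasurableSpace α] (μ : Measure α) (f : α → ℂ) :
    eLpNorm f 2 μ ^ 2 = ∫⁻ x, ‖f x‖ₑ ^ 2 ∂μ := by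
  rw [eLpNorm_eq_lintegral_rpow_enorm_toReal (by simp) (by simp), ← ENNReal.rpow_two,
    ← ENNReal.rpow_mul]
  simp

/-- Mean value inequality on the unit ball around z, where Peetre's inequality changes the weight by
at most 2^N. -/
theorem exists_norm_add_sub_le {V : Type*} [NormedAddCommGroup V] [NormedSpace ℝ V]
    (K : 𝓢(V, ℂ)) (N : ℕ) :
    ∃ C : ℝ, 0 ≤ C ∧ ∀ z d : V, ‖d‖ ≤ 1 → ‖K (z + d) - K z‖ ≤ C * ‖d‖ * ((1 + ‖z‖) ^ N)⁻¹ := by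
  obtain ⟨D, hD₀, hD⟩ := schwartz_decay (fderivCLM ℝ V ℂ K) N
  refine ⟨D * 2 ^ N, by positivity, fun z d hd ↦ ?_⟩
  have h : ∀ y ∈ Metric.closedBall z 1, ‖fderiv ℝ K y‖ ≤ D * 2 ^ N * ((1 + ‖z‖) ^ N)⁻¹ := by
    intro y hy
    refine (hD y).trans ?_
    have h₁ := one_add_norm_sub_pow_inv_le (z - y) z N
    have h₂ : ‖z - y‖ ≤ 1 := by simpa [dist_eq_norm, norm_sub_rev] using hy
    rw [sub_sub_cancel_left, norm_neg] at h₁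
    rw [mul_assoc]
    gcongr
    refine h₁.trans ?_
    gcongr
    linarith
  have h₃ := (convex_closedBall z 1).norm_image_sub_le_of_norm_fderiv_le (𝕜 := ℝ) (f := K)
    (fun y _ ↦ K.differentiableAt) h (x := z) (y := z + d) (by simp) (by simpa using hd)
  rw [add_sub_cancel_left] at h₃
  linarith

/-! ### Estimates for averages: L² bounds, commutators, approximation, Lipschitz constants -/

section Estimates

variable {E : Type} [NormedAddCommGroup E] [InnerProductSpace ℝ E] [FiniteDimensional ℝ E]
  [MeasurableSpace E] [BorelSpace E]

/-- Young's inequality `L¹ * L² → L²` for dilated kernels. -/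
theorem eLpNorm_le_of_enorm_le_lintegral {k : E → ℝ≥0∞} (hk : Measurable k) {w g : E → ℂ}
    (hw : Measurable w) (l : ℝ) (h : ∀ x, ‖g x‖ₑ ≤ ∫⁻ z, k z * ‖w (x - l • z)‖ₑ) :
    eLpNorm g 2 volume ≤ (∫⁻ z, k z) * eLpNorm w 2 volume := by
  refine (ENNReal.pow_le_pow_left_iff two_ne_zero).1 ?_
  rw [mul_pow, eLpNorm_two_sq, eLpNorm_two_sq]
  calc ∫⁻ x, ‖g x‖ₑ ^ 2
      ≤ ∫⁻ x, (∫⁻ z, k z) * ∫⁻ z, k z * ‖w (x - l • z)‖ₑ ^ 2 := by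
        refine lintegral_mono fun x ↦ ?_
        calc ‖g x‖ₑ ^ 2 ≤ (∫⁻ z, k z * ‖w (x - l • z)‖ₑ) ^ 2 := by gcongr; exact h x
          _ ≤ _ := lintegral_mul_sq_le _ hk (by fun_prop)
    _ = (∫⁻ z, k z) * ∫⁻ z, ∫⁻ x, k z * ‖w (x - l • z)‖ₑ ^ 2 := by
        rw [lintegral_const_mul _ (by fun_prop), lintegral_lintegral_swap]
        exact Measurable.aemeasurable (by fun_prop)
    _ = (∫⁻ z, k z) ^ 2 * ∫⁻ x, ‖w x‖ₑ ^ 2 := by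
        have : ∀ z, ∫⁻ x, k z * ‖w (x - l • z)‖ₑ ^ 2 = k z * ∫⁻ x, ‖w x‖ₑ ^ 2 := fun z ↦ by
          rw [lintegral_const_mul _ (by fun_prop),
            lintegral_sub_right_eq_self (fun x ↦ ‖w x‖ₑ ^ 2)]
        simp_rw [this]
        rw [lintegral_mul_const _ hk, sq, mul_assoc]

theorem eLpNorm_avg_le (K : 𝓢(E, ℂ)) (l : ℝ) {w : E → ℂ} (hw : Measurable w) :
    eLpNorm (avg K l w) 2 volume ≤ (∫⁻ z, ‖K z‖ₑ) * eLpNorm w 2 volume := by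
  refine eLpNorm_le_of_enorm_le_lintegral (by fun_prop) hw l fun x ↦ ?_
  refine (enorm_integral_le_lintegral_enorm _).trans_eq ?_
  simp [enorm_mul]

theorem IsTempered.integrable_avg {f : E → ℂ} (hf : IsTempered f) (K : 𝓢(E, ℂ)) {l : ℝ}
    (hl : 0 < l) (x : E) : Integrable fun z ↦ K z * f (x - l • z) := by
  have h := ((hf.integrable_conv (dilate K hl) x).comp_sub_left x).comp_smul hl.ne'
  simp only [sub_sub_cancel, dilate_apply, inv_smul_smul₀ hl.ne', smul_eq_mul] at h
  have hl' : (l : ℂ) ^ Module.finrank ℝ E ≠ 0 := pow_ne_zero _ (by exact_mod_cast hl.ne')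
  refine (h.const_mul ((l : ℂ) ^ Module.finrank ℝ E)).congr (.of_forall fun z ↦ ?_)
  field_simp

/-- The commutator has kernel K(z)(F(x - lz) - F(x)); the increment of F is at most L l ‖z‖, and
Young's inequality with the weight ‖K(z)‖ ‖z‖ finishes. -/
theorem eLpNorm_commutator_le (K : 𝓢(E, ℂ)) {l : ℝ} (hl : 0 < l) {F w : E → ℂ}
    (hF : F.HasTemperateGrowth) {L : ℝ≥0} (hL : LipschitzWith L F) (hw : Measurable w)
    (hw' : IsTempered w) :
    eLpNorm (avg K l (fun x ↦ F x * w x) - fun x ↦ F x * avg K l w x) 2 volume ≤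
      L * ENNReal.ofReal l * (∫⁻ z, ‖K z‖ₑ * ‖z‖ₑ) * eLpNorm w 2 volume := by
  obtain ⟨k, C, hC⟩ := hF.2 0
  have hFw : IsTempered (fun x ↦ F x * w x) :=
    hw'.bound_mul hF.1.continuous.aestronglyMeasurable (by simpa using hC)
  rw [← lintegral_const_mul _ (by fun_prop)]
  refine eLpNorm_le_of_enorm_le_lintegral (by fun_prop) hw l fun x ↦ ?_
  have h : (avg K l (fun x ↦ F x * w x) - fun x ↦ F x * avg K l w x) x =
      ∫ z, K z * (F (x - l • z) - F x) * w (x - l • z) := by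
    simp only [Pi.sub_apply, avg]
    rw [← integral_const_mul, ← integral_sub (hFw.integrable_avg K hl x)
      ((hw'.integrable_avg K hl x).const_mul _)]
    congr with z
    ring
  rw [h]
  refine (enorm_integral_le_lintegral_enorm _).trans (lintegral_mono fun z ↦ ?_)
  rw [enorm_mul, enorm_mul]
  have h₁ : ‖F (x - l • z) - F x‖ₑ ≤ L * (ENNReal.ofReal l * ‖z‖ₑ) := by
    have := hL (x - l • z) x
    rwa [edist_eq_enorm_sub, edist_eq_enorm_sub, sub_sub_cancel_left, enorm_neg, enorm_smul,
      Real.enorm_of_nonneg hl.le] at this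
  calc _ ≤ ‖K z‖ₑ * (L * (ENNReal.ofReal l * ‖z‖ₑ)) * ‖w (x - l • z)‖ₑ := by gcongr
    _ = _ := by ring

theorem integrable_weight_mul (K : 𝓢(E, ℂ)) : Integrable fun z ↦ ‖K z‖ * (1 + ‖z‖) := by
  have h₁ := K.integrable_pow_mul volume 0
  have h₂ := K.integrable_pow_mul volume 1
  refine (h₁.add h₂).congr (.of_forall fun z ↦ ?_)
  simp only [Pi.add_apply]
  ring

theorem norm_avg_sub_le {a : E → ℂ} (ha : IsTempered a) (K : 𝓢(E, ℂ)) {l B : ℝ} (hl : 0 < l)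
    (hB : ∀ x z, ‖a (x - l • z) - a x‖ ≤ B * (1 + ‖z‖)) (x : E) :
    ‖avg K l a x - (∫ z, K z) * a x‖ ≤ B * ∫ z, ‖K z‖ * (1 + ‖z‖) := by
  rw [avg, ← integral_mul_const, ← integral_sub (ha.integrable_avg K hl x)
    (K.integrable.mul_const _), ← integral_const_mul]
  refine norm_integral_le_of_norm_le ((integrable_weight_mul K).const_mul B) (.of_forall fun z ↦ ?_)
  rw [← mul_sub, norm_mul]
  calc _ ≤ ‖K z‖ * (B * (1 + ‖z‖)) := by gcongr; exact hB x z
    _ = _ := by ring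

theorem integrable_weight_mul_comp_add (K : 𝓢(E, ℂ)) (d : E) :
    Integrable fun z ↦ ‖K (z + d)‖ * (1 + ‖z‖) := by
  refine (((integrable_weight_mul K).comp_add_right d).mul_const (1 + ‖d‖)).mono'
    (Continuous.aestronglyMeasurable (by fun_prop)) (.of_forall fun z ↦ ?_)
  rw [Real.norm_of_nonneg (by positivity), mul_assoc]
  gcongr
  have : ‖z‖ ≤ ‖z + d‖ + ‖d‖ := by simpa using norm_sub_le (z + d) d
  nlinarith [norm_nonneg d, norm_nonneg (z + d)]

theorem integrable_weight_mul_sub (K : 𝓢(E, ℂ)) (d : E) :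
    Integrable fun z ↦ ‖K (z + d) - K z‖ * (1 + ‖z‖) := by
  refine ((integrable_weight_mul_comp_add K d).add (integrable_weight_mul K)).mono'
    (Continuous.aestronglyMeasurable (by fun_prop)) (.of_forall fun z ↦ ?_)
  rw [Real.norm_of_nonneg (by positivity)]
  simp only [Pi.add_apply, ← add_mul]
  gcongr
  exact norm_sub_le _ _

/-- For ‖d‖ ≤ 1 the mean value bound gives the factor ‖d‖. For ‖d‖ ≥ 1 the triangle inequality
suffices, since translating the weight 1 + ‖z‖ costs at most 1 + ‖d‖. -/
theorem exists_integral_weight_mul_sub_le (K : 𝓢(E, ℂ)) :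
    ∃ C : ℝ, 0 ≤ C ∧ ∀ d : E, ∫ z, ‖K (z + d) - K z‖ * (1 + ‖z‖) ≤ C * ‖d‖ := by
  set p := (volume : Measure E).integrablePower
  obtain ⟨D, hD₀, hD⟩ := exists_norm_add_sub_le K (p + 1)
  have hJ : Integrable (fun z : E ↦ (1 + ‖z‖) ^ (-(p : ℝ))) :=
    Measure.integrable_pow_neg_integrablePower (volume : Measure E)
  set J := ∫ z : E, (1 + ‖z‖) ^ (-(p : ℝ))
  set I := ∫ z, ‖K z‖ * (1 + ‖z‖)
  have hJ₀ : 0 ≤ J := integral_nonneg fun z ↦ by positivity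
  have hI₀ : 0 ≤ I := integral_nonneg fun z ↦ by positivity
  refine ⟨D * J + 3 * I, by positivity, fun d ↦ ?_⟩
  rcases le_total ‖d‖ 1 with hd | hd
  · calc ∫ z, ‖K (z + d) - K z‖ * (1 + ‖z‖) ≤ ∫ z : E, D * ‖d‖ * (1 + ‖z‖) ^ (-(p : ℝ)) := by
          refine integral_mono (integrable_weight_mul_sub K d) (hJ.const_mul _) fun z ↦ ?_
          rw [Real.rpow_neg (by positivity), Real.rpow_natCast]
          calc _ ≤ D * ‖d‖ * ((1 + ‖z‖) ^ (p + 1))⁻¹ * (1 + ‖z‖) := by gcongr; exact hD z d hd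
            _ = _ := by rw [pow_succ]; field_simp
      _ = D * J * ‖d‖ := by rw [integral_const_mul]; ring
      _ ≤ _ := by gcongr; linarith
  · have h₁ : ∫ z, ‖K (z + d)‖ * (1 + ‖z‖) ≤ (1 + ‖d‖) * I := by
      have h₂ := integral_add_right_eq_self (μ := volume) (fun z ↦ ‖K z‖ * (1 + ‖z - d‖)) d
      simp only [add_sub_cancel_right] at h₂
      rw [h₂, ← integral_const_mul]
      refine integral_mono_of_nonneg (.of_forall fun z ↦ by positivity)
        ((integrable_weight_mul K).const_mul _) (.of_forall fun z ↦ ?_)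
      have h₃ := norm_sub_le z d
      calc ‖K z‖ * (1 + ‖z - d‖) ≤ ‖K z‖ * ((1 + ‖d‖) * (1 + ‖z‖)) := by
            gcongr
            nlinarith [norm_nonneg z, norm_nonneg d]
        _ = _ := by ring
    calc ∫ z, ‖K (z + d) - K z‖ * (1 + ‖z‖)
        ≤ ∫ z, (‖K (z + d)‖ * (1 + ‖z‖) + ‖K z‖ * (1 + ‖z‖)) := by
          refine integral_mono (integrable_weight_mul_sub K d)
            ((integrable_weight_mul_comp_add K d).add (integrable_weight_mul K)) fun z ↦ ?_
          simp only [← add_mul]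
          gcongr
          exact norm_sub_le _ _
      _ = (∫ z, ‖K (z + d)‖ * (1 + ‖z‖)) + I :=
          integral_add (integrable_weight_mul_comp_add K d) (integrable_weight_mul K)
      _ ≤ (1 + ‖d‖) * I + I := by gcongr
      _ ≤ 3 * I * ‖d‖ := by nlinarith
      _ ≤ _ := by gcongr; nlinarith

theorem norm_avg_add_sub_avg_le {a : E → ℂ} (ha : IsTempered a) (K : 𝓢(E, ℂ)) {l B : ℝ}
    (hl : 0 < l) (hB : ∀ x z, ‖a (x - l • z) - a x‖ ≤ B * (1 + ‖z‖)) (x d : E) :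
    ‖avg K l a (x + l • d) - avg K l a x‖ ≤ B * ∫ z, ‖K (z + d) - K z‖ * (1 + ‖z‖) := by
  have h₁ := integral_add_right_eq_self (μ := volume) (fun z ↦ K z * a (x + l • d - l • z)) d
  have h₂ := (ha.integrable_avg K hl (x + l • d)).comp_add_right d
  have h₃ : ∀ z, x + l • d - l • (z + d) = x - l • z := fun z ↦ by rw [smul_add]; abel
  simp only [h₃] at h₁ h₂
  -- A difference of translates of K has mean zero, so a(x) can be subtracted from a(x - lz) for
  -- free; only increments of a remain.
  have h₄ : ∫ z, (K (z + d) - K z) * a x = 0 := by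
    rw [integral_mul_const, integral_sub (K.integrable.comp_add_right d) K.integrable,
      integral_add_right_eq_self (μ := volume) K, sub_self, zero_mul]
  have h₅ : avg K l a (x + l • d) - avg K l a x =
      ∫ z, (K (z + d) - K z) * (a (x - l • z) - a x) := by
    have h₆ := (ha.integrable_avg K hl x)
    have h₇ : Integrable fun z ↦ (K (z + d) - K z) * a x :=
      ((K.integrable.comp_add_right d).sub K.integrable).mul_const _
    rw [avg, avg, ← h₁, ← integral_sub h₂ h₆, ← sub_zero (integral _ _), ← h₄,
      ← integral_sub (by exact h₂.sub h₆) h₇]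
    congr with z
    ring
  rw [h₅, ← integral_const_mul]
  refine norm_integral_le_of_norm_le ((integrable_weight_mul_sub K d).const_mul B)
    (.of_forall fun z ↦ ?_)
  rw [norm_mul]
  calc _ ≤ ‖K (z + d) - K z‖ * (B * (1 + ‖z‖)) := by gcongr; exact hB x z
    _ = _ := by ring

theorem exists_norm_avg_sub_avg_le (K : 𝓢(E, ℂ)) : ∃ C : ℝ, 0 ≤ C ∧ ∀ {a : E → ℂ} {l B : ℝ},
    IsTempered a → 0 < l → 0 ≤ B → (∀ x z, ‖a (x - l • z) - a x‖ ≤ B * (1 + ‖z‖)) → ∀ x y,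
      ‖avg K l a x - avg K l a y‖ ≤ C * B * l⁻¹ * ‖x - y‖ := by
  obtain ⟨C, hC₀, hC⟩ := exists_integral_weight_mul_sub_le K
  refine ⟨C, hC₀, fun {a l B} ha hl hB₀ hB x y ↦ ?_⟩
  have h := norm_avg_add_sub_avg_le ha K hl hB y (l⁻¹ • (x - y))
  rw [smul_inv_smul₀ hl.ne', add_sub_cancel] at h
  refine h.trans ((mul_le_mul_of_nonneg_left (hC _) hB₀).trans_eq ?_)
  rw [norm_smul, Real.norm_of_nonneg (by positivity)]
  ring

end Estimates

/-! ### Moduli of continuity and pointwise bounds in C^ω -/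

section Modulus

variable {ω : ℝ → ℝ}

/-- The extension of a modulus of continuity from `[0,1]` to `[0,∞)` by a constant. -/
def extend (ω : ℝ → ℝ) (t : ℝ) : ℝ := ω (min 1 t)

theorem extend_of_one_le {t : ℝ} (ht : 1 ≤ t) : extend ω t = ω 1 := by rw [extend, min_eq_left ht]

theorem extend_of_le_one {t : ℝ} (ht : t ≤ 1) : extend ω t = ω t := by rw [extend, min_eq_right ht]

theorem IsModulus.pos (hω : IsModulus ω) {t : ℝ} (h₀ : 0 < t) (h₁ : t ≤ 1) : 0 < ω t := by
  have := hω.strictMonoOn (show (0 : ℝ) ∈ Set.Icc 0 1 by simp) ⟨h₀.le, h₁⟩ h₀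
  rwa [hω.map_zero] at this

theorem IsModulus.extend_pos (hω : IsModulus ω) {t : ℝ} (h₀ : 0 < t) : 0 < extend ω t :=
  hω.pos (lt_min one_pos h₀) (min_le_left _ _)

theorem IsModulus.extend_nonneg (hω : IsModulus ω) {t : ℝ} (h₀ : 0 ≤ t) : 0 ≤ extend ω t := by
  rcases h₀.eq_or_lt with rfl | h
  · simp [extend, hω.map_zero]
  · exact (hω.extend_pos h).le

theorem IsModulus.extend_mono (hω : IsModulus ω) {t t' : ℝ} (h₀ : 0 ≤ t) (h : t ≤ t') :
    extend ω t ≤ extend ω t' :=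
  hω.strictMonoOn.monotoneOn ⟨le_min zero_le_one h₀, min_le_left _ _⟩
    ⟨le_min zero_le_one (h₀.trans h), min_le_left _ _⟩ (min_le_min_left _ h)

/-- Concavity along the chord from the origin, where ω vanishes, gives ω(r)/c ≤ ω(r/c); take r =
min(1, ct). -/
theorem IsModulus.extend_mul_le_of_one_le (hω : IsModulus ω) {c t : ℝ} (hc : 1 ≤ c) (ht : 0 ≤ t) :
    extend ω (c * t) ≤ c * extend ω t := by
  have hc₀ : 0 < c := by linarith
  have hs : min 1 (c * t) ∈ Set.Icc (0 : ℝ) 1 :=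
    ⟨le_min zero_le_one (by positivity), min_le_left _ _⟩
  have h := hω.concaveOn.2 hs (show (0 : ℝ) ∈ Set.Icc 0 1 by simp) (inv_nonneg.2 hc₀.le)
    (sub_nonneg.2 (inv_le_one_of_one_le₀ hc)) (by ring)
  simp only [smul_eq_mul, hω.map_zero, mul_zero, add_zero] at h
  have h₁ : c⁻¹ * min 1 (c * t) ≤ min 1 t := by
    refine le_min ?_ ?_
    · exact mul_le_one₀ (inv_le_one_of_one_le₀ hc) hs.1 hs.2
    · rw [inv_mul_le_iff₀ hc₀]
      exact min_le_right _ _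
  have h₂ : ω (c⁻¹ * min 1 (c * t)) ≤ extend ω t :=
    hω.strictMonoOn.monotoneOn ⟨mul_nonneg (by positivity) hs.1, h₁.trans (min_le_left _ _)⟩
      ⟨le_min zero_le_one ht, min_le_left _ _⟩ h₁
  have h₃ := h.trans h₂
  rwa [inv_mul_le_iff₀ hc₀] at h₃

theorem IsModulus.extend_mul_le (hω : IsModulus ω) {c t : ℝ} (hc : 0 ≤ c) (ht : 0 ≤ t) :
    extend ω (c * t) ≤ (1 + c) * extend ω t := by
  refine (hω.extend_mono (by positivity) ?_).trans (hω.extend_mul_le_of_one_le (by linarith) ht)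
  gcongr
  linarith

theorem MemC.normC_lt_top {n : ℕ} (hω : IsModulus ω) {a : Rn n → ℂ} (ha : MemC ω a) :
    normC ω a < ∞ :=
  ENNReal.add_lt_top.2 ⟨(ha.memLp hω).2, ha.seminorm_lt_top⟩

theorem MemC.norm_le {n : ℕ} (hω : IsModulus ω) {a : Rn n → ℂ} (ha : MemC ω a) (x : Rn n) :
    ‖a x‖ ≤ (normC ω a).toReal := by
  have hc := ha.continuous hω
  set M := (eLpNorm a ∞ volume).toReal
  have h₁ : ∀ᵐ x, ‖a x‖ ≤ M := by
    filter_upwards [enorm_ae_le_eLpNormEssSup a volume] with x hx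
    rw [← eLpNorm_exponent_top] at hx
    exact ENNReal.toReal_mono (ha.memLp hω).2.ne hx
  -- The essential bound holds everywhere: this maximum is continuous and almost everywhere equal to
  -- a constant.
  have h₂ : (fun x ↦ max ‖a x‖ M) = fun _ ↦ M := by
    refine (Continuous.ae_eq_iff_eq volume (by fun_prop) (by fun_prop)).1 ?_
    filter_upwards [h₁] with x hx
    exact max_eq_right hx
  refine (max_eq_right_iff.1 (congrFun h₂ x)).trans ?_
  exact ENNReal.toReal_mono (ha.normC_lt_top hω).ne le_self_add

/-- The 1 in the constant serves distances below 1, through the seminorm. The 2/ω(1) serves larger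
distances, where the sup norm bounds the difference and the extended modulus equals ω(1). -/
theorem MemC.norm_sub_le {n : ℕ} (hω : IsModulus ω) {a : Rn n → ℂ} (ha : MemC ω a) (x y : Rn n) :
    ‖a x - a y‖ ≤ (1 + 2 / ω 1) * (normC ω a).toReal * extend ω ‖x - y‖ := by
  have h1 := hω.pos one_pos le_rfl
  set A := (normC ω a).toReal
  have hA : 0 ≤ A := ENNReal.toReal_nonneg
  rcases eq_or_ne x y with rfl | hne
  · have := hω.extend_nonneg le_rfl
    simp [extend, hω.map_zero]
  have h₀ : 0 < dist x y := dist_pos.2 hne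
  rw [← dist_eq_norm x y]
  rcases lt_or_ge (dist x y) 1 with h | h
  · rw [extend_of_le_one h.le]
    have hpos := hω.pos h₀ h.le
    have hle : ‖a x - a y‖ₑ / ENNReal.ofReal (ω (dist x y)) ≤ normC ω a := by
      refine le_trans ?_ (le_add_left le_rfl)
      exact le_iSup_of_le x (le_iSup_of_le y (le_iSup_of_le ⟨h₀, h⟩ le_rfl))
    rw [ENNReal.div_le_iff (by simpa using hpos) (by simp)] at hle
    have h2 := ENNReal.toReal_mono
      (ENNReal.mul_ne_top (ha.normC_lt_top hω).ne ENNReal.ofReal_ne_top) hle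
    rw [ENNReal.toReal_mul, ENNReal.toReal_ofReal hpos.le, toReal_enorm] at h2
    refine h2.trans ?_
    gcongr
    have : 0 ≤ 2 / ω 1 := by positivity
    nlinarith
  · rw [extend_of_one_le h]
    calc ‖a x - a y‖ ≤ A + A :=
          (_root_.norm_sub_le _ _).trans (add_le_add (ha.norm_le hω x) (ha.norm_le hω y))
      _ ≤ A * ω 1 + 2 * A := by nlinarith
      _ = _ := by field_simp

theorem MemC.norm_sub_smul_sub_le {n : ℕ} (hω : IsModulus ω) {a : Rn n → ℂ} (ha : MemC ω a)
    {l : ℝ} (hl : 0 < l) (x z : Rn n) :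
    ‖a (x - l • z) - a x‖ ≤ (1 + 2 / ω 1) * (normC ω a).toReal * extend ω l * (1 + ‖z‖) := by
  have h1 := hω.pos one_pos le_rfl
  refine (ha.norm_sub_le hω _ _).trans ?_
  rw [sub_sub_cancel_left, norm_neg, norm_smul, Real.norm_of_nonneg hl.le, mul_comm l,
    mul_assoc _ (extend ω l)]
  gcongr
  rw [mul_comm (extend ω l)]
  exact hω.extend_mul_le (norm_nonneg z) hl.le

theorem MemC.norm_le_extend {n : ℕ} (hω : IsModulus ω) {a : Rn n → ℂ} (ha : MemC ω a)
    {l : ℝ} (hl : 1 ≤ l) (x : Rn n) :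
    ‖a x‖ ≤ (1 + 2 / ω 1) * (normC ω a).toReal * extend ω l := by
  have h1 := hω.pos one_pos le_rfl
  have hA : 0 ≤ (normC ω a).toReal := ENNReal.toReal_nonneg
  rw [extend_of_one_le hl]
  calc _ ≤ (normC ω a).toReal := ha.norm_le hω x
    _ ≤ (normC ω a).toReal * ω 1 + 2 * (normC ω a).toReal := by nlinarith
    _ = _ := by field_simp

theorem MemC.isTempered {n : ℕ} (hω : IsModulus ω) {a : Rn n → ℂ} (ha : MemC ω a) :
    IsTempered a := .of_memLp le_top (ha.memLp hω)

theorem isRep_ofBounded {n : ℕ} {a : Rn n → ℂ} (ha : MemLp a ∞ (volume : Measure (Rn n))) :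
    IsRep (ofBounded a ha) a :=
  (IsRep.lp (ha.toLp a)).congr ha.coeFn_toLp

end Modulus

/-! ### Kernels of the Littlewood-Paley operators -/

section Kernels

variable {n : ℕ}

open FourierTransform in
-- The factor 2π of D is absorbed into the symbol, so a single kernel serves all q. Its mean is the
-- value of the symbol at the origin, which decides which cancellation is available.
theorem exists_kernel {m : Rn n → ℝ} (hm : ContDiff ℝ (⊤ : ℕ∞) m) (hs : HasCompactSupport m) :
    ∃ K : 𝓢(Rn n, ℂ), ∫ z, K z = m 0 ∧ ∀ (q : ℤ) (u : 𝓢'(Rn n, ℂ)) (f : Rn n → ℂ), IsRep u f →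
      (avg K ((2 : ℝ) ^ (-q)) f).HasTemperateGrowth ∧
        IsRep (dyadicMultiplier m q u) (avg K ((2 : ℝ) ^ (-q)) f) := by
  have hπ : 2 * Real.pi ≠ 0 := by positivity
  have h₁ : HasCompactSupport fun ξ : Rn n ↦ ((m ((2 * Real.pi) • ξ) : ℝ) : ℂ) :=
    (hs.comp_smul hπ).comp_left (g := Complex.ofReal) Complex.ofReal_zero
  have h₂ : ContDiff ℝ (⊤ : ℕ∞) fun ξ : Rn n ↦ ((m ((2 * Real.pi) • ξ) : ℝ) : ℂ) :=
    Complex.ofRealCLM.contDiff.comp (hm.comp (contDiff_const_smul _))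
  refine ⟨𝓕⁻ (h₁.toSchwartzMap h₂), ?_, fun q u f hu ↦ ?_⟩
  · have h := congrArg (fun g : 𝓢(Rn n, ℂ) ↦ g 0)
      (fourier_fourierInv_eq (E := 𝓢(Rn n, ℂ)) (F := 𝓢(Rn n, ℂ)) (h₁.toSchwartzMap h₂))
    beta_reduce at h
    rw [fourier_coe, Real.fourier_eq] at h
    simpa using h
  · have h := hu.fourierMultiplier (h₁.toSchwartzMap h₂) (l := (2 : ℝ) ^ (-q)) (by positivity)
    refine ⟨h.1, ?_⟩
    convert! h.2 using 2
    rw [dyadicMultiplier]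
    congr 2 with ξ
    rw [HasCompactSupport.toSchwartzMap_toFun, smul_comm]

theorem IsDyadicPartition.hasCompactSupport_chi {χ φ : Rn n → ℝ} (h : IsDyadicPartition χ φ) :
    HasCompactSupport χ := by
  refine (isCompact_closedBall (0 : Rn n) (4 / 3)).of_isClosed_subset (isClosed_tsupport _) ?_
  intro ξ hξ
  simpa using h.tsupport_chi hξ

theorem IsDyadicPartition.hasCompactSupport_phi {χ φ : Rn n → ℝ} (h : IsDyadicPartition χ φ) :
    HasCompactSupport φ := by
  refine (isCompact_closedBall (0 : Rn n) (8 / 3)).of_isClosed_subset (isClosed_tsupport _) ?_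
  intro ξ hξ
  simpa using (h.tsupport_phi hξ).2

theorem IsDyadicPartition.phi_eq_zero {χ φ : Rn n → ℝ} (h : IsDyadicPartition χ φ) {ξ : Rn n}
    (hξ : ‖ξ‖ < 3 / 4) : φ ξ = 0 :=
  image_eq_zero_of_notMem_tsupport fun h' ↦ (not_le.2 hξ) (h.tsupport_phi h').1

theorem IsDyadicPartition.chi_eq_zero {χ φ : Rn n → ℝ} (h : IsDyadicPartition χ φ) {ξ : Rn n}
    (hξ : 4 / 3 < ‖ξ‖) : χ ξ = 0 :=
  image_eq_zero_of_notMem_tsupport fun h' ↦ (not_le.2 hξ) (h.tsupport_chi h')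

theorem IsDyadicPartition.chi_eq_one {χ φ : Rn n → ℝ} (h : IsDyadicPartition χ φ) {ξ : Rn n}
    (hξ : ‖ξ‖ < 3 / 4) : χ ξ = 1 := by
  have h₁ : ∀ q : ℕ, φ ((2 : ℝ) ^ (-(q : ℤ)) • ξ) = 0 := fun q ↦ by
    refine h.phi_eq_zero (lt_of_le_of_lt ?_ hξ)
    rw [norm_smul, Real.norm_of_nonneg (by positivity)]
    refine mul_le_of_le_one_left (norm_nonneg _) ?_
    exact zpow_le_one_of_nonpos₀ one_le_two (by simp)
  have h₂ := h.hasSum ξ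
  simp_rw [h₁] at h₂
  linarith [h₂.unique hasSum_zero]

/-- Kernels of the dyadic blocks and of the low frequency cut-offs. -/
theorem IsDyadicPartition.exists_kernels {χ φ : Rn n → ℝ} (h : IsDyadicPartition χ φ) :
    ∃ KD KS : ℤ → 𝓢(Rn n, ℂ),
      ((Set.range KD).Finite ∧ (∀ q, 0 ≤ q → ∫ z, KD q z = 0) ∧ ∀ q u f, IsRep u f →
        (avg (KD q) ((2 : ℝ) ^ (-q)) f).HasTemperateGrowth ∧
          IsRep (Delta χ φ q u) (avg (KD q) ((2 : ℝ) ^ (-q)) f)) ∧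
      ((Set.range KS).Finite ∧ (∀ q, 0 ≤ q → ∫ z, KS q z = 1) ∧ (∀ q < 0, KS q = 0) ∧
        ∀ q u f, IsRep u f →
        (avg (KS q) ((2 : ℝ) ^ (-q)) f).HasTemperateGrowth ∧
          IsRep (S χ q u) (avg (KS q) ((2 : ℝ) ^ (-q)) f)) := by
  obtain ⟨Kχ, h₁, h₁'⟩ := exists_kernel h.contDiff_chi h.hasCompactSupport_chi
  obtain ⟨Kφ, h₂, h₂'⟩ := exists_kernel h.contDiff_phi h.hasCompactSupport_phi
  -- For q = -1 the scale 2^{-q} is 2, so the block χ(D) is written with symbol χ(ξ/2) dilated back.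
  obtain ⟨K, -, h₃'⟩ := exists_kernel (m := fun ξ ↦ χ ((2 : ℝ)⁻¹ • ξ))
    (h.contDiff_chi.comp (contDiff_const_smul _))
    (h.hasCompactSupport_chi.comp_smul (by norm_num))
  have hzero : ∀ (l : ℝ) (f : Rn n → ℂ), avg 0 l f = 0 := fun l f ↦ by ext x; simp [avg]
  refine ⟨fun q ↦ if q ≤ -2 then 0 else if q = -1 then K else Kφ, fun q ↦ if 0 ≤ q then Kχ else 0,
    ⟨?_, fun q hq ↦ ?_, fun q u f hu ↦ ?_⟩, ?_, fun q hq ↦ ?_, fun q hq ↦ ?_, fun q u f hu ↦ ?_⟩ <;>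
    beta_reduce
  · refine (Set.toFinite {0, K, Kφ}).subset ?_
    rintro _ ⟨q, rfl⟩
    beta_reduce
    split_ifs <;> simp
  · rw [if_neg (by omega), if_neg (by omega), h₂, h.phi_eq_zero (by simp)]
    simp
  · rw [Delta]
    split_ifs with h₄ h₅
    · rw [hzero]
      exact ⟨.zero, .zero⟩
    · have h₆ : dyadicMultiplier χ 0 = dyadicMultiplier (fun ξ ↦ χ ((2 : ℝ)⁻¹ • ξ)) (-1) := by
        simp only [dyadicMultiplier]
        congr 1
        ext ξ
        simp
      rw [h₆, h₅]
      exact h₃' (-1) u f hu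
    · exact h₂' q u f hu
  · refine (Set.toFinite {0, Kχ}).subset ?_
    rintro _ ⟨q, rfl⟩
    beta_reduce
    split_ifs <;> simp
  · rw [if_pos hq, h₁, h.chi_eq_one (by simp)]
    simp
  · rw [if_neg (by omega)]
  · rw [S]
    split_ifs with h₄
    · exact h₁' q u f hu
    · rw [hzero]
      exact ⟨.zero, .zero⟩

theorem exists_bound_of_finite_range {α β : Type*} {K : α → β} (h : (Set.range K).Finite)
    (Φ : β → ℝ) : ∃ C : ℝ, 0 ≤ C ∧ ∀ q, Φ (K q) ≤ C := by
  obtain ⟨C, hC⟩ := (h.image Φ).bddAbove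
  exact ⟨max C 0, le_max_right _ _, fun q ↦ (hC ⟨_, ⟨q, rfl⟩, rfl⟩).trans (le_max_left _ _)⟩

theorem exists_enorm_bound_of_finite_range {α β : Type*} {K : α → β} (h : (Set.range K).Finite)
    (Φ : β → ℝ≥0∞) (hΦ : ∀ k, Φ k < ∞) : ∃ C : ℝ≥0, ∀ q, Φ (K q) ≤ C := by
  obtain ⟨C, hC₀, hC⟩ := exists_bound_of_finite_range h (fun k ↦ (Φ k).toReal)
  refine ⟨⟨C, hC₀⟩, fun q ↦ ?_⟩
  rw [← ENNReal.ofReal_toReal (hΦ (K q)).ne]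
  exact (ENNReal.ofReal_le_ofReal (hC q)).trans_eq
    (ENNReal.ofReal_eq_coe_nnreal hC₀)

end Kernels

/-! ### The L² norm on tempered distributions -/

section L2norm

variable {n : ℕ}

theorem L2norm_zero : L2norm (0 : 𝓢'(Rn n, ℂ)) = 0 := by
  have := (IsRep.zero (E := Rn n)).L2norm_le
  simpa using this

theorem L2norm_add_le (u v : 𝓢'(Rn n, ℂ)) : L2norm (u + v) ≤ L2norm u + L2norm v := by
  rcases eq_or_ne (L2norm u) ∞ with hu | hu
  · simp [hu]
  rcases eq_or_ne (L2norm v) ∞ with hv | hv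
  · simp [hv]
  obtain ⟨f, hf, hfm, hf'⟩ := exists_memLp_of_L2norm_lt_top (lt_top_iff_ne_top.2 hu)
  obtain ⟨g, hg, hgm, hg'⟩ := exists_memLp_of_L2norm_lt_top (lt_top_iff_ne_top.2 hv)
  rw [← hf', ← hg']
  exact (hf.add hg).L2norm_le.trans
    (eLpNorm_add_le hfm.aestronglyMeasurable hgm.aestronglyMeasurable one_le_two)

theorem L2norm_sum_le {ι : Type*} (s : Finset ι) (u : ι → 𝓢'(Rn n, ℂ)) :
    L2norm (∑ i ∈ s, u i) ≤ ∑ i ∈ s, L2norm (u i) :=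
  Finset.le_sum_of_subadditive L2norm L2norm_zero.le L2norm_add_le s u

theorem L2norm_lp_le (f : Lp ℂ 2 (volume : Measure (Rn n))) :
    L2norm (Lp.toTemperedDistribution f) ≤ ‖f‖ₑ :=
  iInf₂_le f (rfl : Lp.toTemperedDistribution f = Lp.toTemperedDistribution f)

/-- A series of tempered distributions converges if the series of the `L²` norms does. -/
theorem summable_of_tsum_L2norm_lt_top {ι : Type*} {u : ι → 𝓢'(Rn n, ℂ)}
    (h : ∑' i, L2norm (u i) < ∞) : Summable u ∧ L2norm (∑' i, u i) ≤ ∑' i, L2norm (u i) := by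
  choose f hf hf' using fun i ↦
    exists_isRep_of_L2norm_lt_top ((ENNReal.le_tsum (f := fun i ↦ L2norm (u i)) i).trans_lt h)
  have hs : Summable fun i ↦ ‖f i‖ := by
    have : ∑' i, ‖f i‖ₑ ≠ ∞ := by simpa only [hf'] using h.ne
    have := ENNReal.summable_toReal this
    simpa using this
  -- Absolute convergence takes place in the Banach space L² and is carried over by its continuous
  -- embedding.
  have hsum := (hs.of_norm.hasSum).mapL (Lp.toTemperedDistributionCLM ℂ (volume : Measure (Rn n)) 2)
  simp only [Lp.toTemperedDistributionCLM_apply, hf] at hsum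
  refine ⟨hsum.summable, ?_⟩
  rw [hsum.tsum_eq]
  simp_rw [← hf']
  refine (L2norm_lp_le (∑' i, f i)).trans ?_
  exact enorm_tsum_le_tsum_enorm

theorem L2norm_mul_le {u v : 𝓢'(Rn n, ℂ)} {F : Rn n → ℂ} (hF : F.HasTemperateGrowth)
    (hu : IsRep u F) {B : ℝ} (hB : ∀ x, ‖F x‖ ≤ B) (hv : L2norm v < ∞) :
    L2norm (mul u v) ≤ ENNReal.ofReal B * L2norm v := by
  obtain ⟨w, hw, hwm, hw'⟩ := exists_memLp_of_L2norm_lt_top hv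
  rw [← hw']
  refine (hu.mul hF hw).L2norm_le.trans ?_
  refine eLpNorm_le_mul_eLpNorm_of_ae_le_mul (.of_forall fun x ↦ ?_) 2
  rw [norm_mul]
  gcongr
  exact hB x

end L2norm

/-! ### Dyadic bounds for a and the single terms of R1 and R2 -/

section Blocks

variable {n : ℕ} {χ φ : Rn n → ℝ} {ω : ℝ → ℝ}

theorem exists_L2norm_Delta_le (h : IsDyadicPartition χ φ) :
    ∃ C : ℝ≥0, ∀ (q : ℤ) (v : 𝓢'(Rn n, ℂ)), L2norm v < ∞ →
      L2norm (Delta χ φ q v) ≤ C * L2norm v := by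
  obtain ⟨KD, -, ⟨hfin, -, hrep⟩, -⟩ := h.exists_kernels
  obtain ⟨C, hC⟩ := exists_enorm_bound_of_finite_range hfin (fun K ↦ ∫⁻ z, ‖K z‖ₑ)
    (fun K ↦ K.integrable.2)
  refine ⟨C, fun q v hv ↦ ?_⟩
  obtain ⟨w, hw, hwm, hw'⟩ := exists_memLp_of_L2norm_lt_top hv
  rw [← hw']
  refine (hrep q v w hw).2.L2norm_le.trans ((eLpNorm_avg_le _ _ hwm).trans ?_)
  gcongr
  exact hC q

theorem exists_L2norm_commutator_le (h : IsDyadicPartition χ φ) :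
    ∃ C : ℝ≥0, ∀ (q : ℤ) (u v : 𝓢'(Rn n, ℂ)) (F : Rn n → ℂ) (L : ℝ≥0), F.HasTemperateGrowth →
      LipschitzWith L F → IsRep u F → L2norm v < ∞ →
      L2norm (Delta χ φ q (mul u v) - mul u (Delta χ φ q v)) ≤
        C * L * ENNReal.ofReal ((2 : ℝ) ^ (-q)) * L2norm v := by
  obtain ⟨KD, -, ⟨hfin, -, hrep⟩, -⟩ := h.exists_kernels
  obtain ⟨C, hC⟩ := exists_enorm_bound_of_finite_range hfin (fun K ↦ ∫⁻ z, ‖K z‖ₑ * ‖z‖ₑ)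
    (fun K ↦ by
      have := (K.integrable_pow_mul volume 1).2
      rw [hasFiniteIntegral_iff_enorm] at this
      simpa [enorm_mul, mul_comm] using this)
  refine ⟨C, fun q u v F L hF hL hu hv ↦ ?_⟩
  obtain ⟨w, hw, hwm, hw'⟩ := exists_memLp_of_L2norm_lt_top hv
  rw [← hw']
  have h₁ := (hrep q _ _ (hu.mul hF hw)).2.sub (hu.mul hF (hrep q v w hw).2)
  refine h₁.L2norm_le.trans
    ((eLpNorm_commutator_le _ (by positivity) hF hL hwm hw.isTempered).trans ?_)
  calc _ ≤ L * ENNReal.ofReal ((2 : ℝ) ^ (-q)) * C * eLpNorm w 2 volume := by gcongr; exact hC q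
    _ = _ := by ring

/-- Approximation and Lipschitz bounds for the low frequency cut-offs of `a ∈ C^ω`. -/
theorem exists_S_bounds (h : IsDyadicPartition χ φ) (hω : IsModulus ω) :
    ∃ C : ℝ, 0 ≤ C ∧ ∀ (a : Rn n → ℂ) (ha : MemC ω a) (p : ℤ), ∃ F : Rn n → ℂ,
      F.HasTemperateGrowth ∧ IsRep (S χ p (ofBounded a (ha.memLp hω))) F ∧
      (∀ x, ‖F x - a x‖ ≤ C * (normC ω a).toReal * extend ω ((2 : ℝ) ^ (-p))) ∧
      ∀ x y, ‖F x - F y‖ ≤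
        C * (normC ω a).toReal * extend ω ((2 : ℝ) ^ (-p)) * (2 : ℝ) ^ p * ‖x - y‖ := by
  obtain ⟨-, KS, -, hfin, hint, hneg, hrep⟩ := h.exists_kernels
  obtain ⟨C₁, hC₁, hI⟩ := exists_bound_of_finite_range hfin (fun K ↦ ∫ z, ‖K z‖ * (1 + ‖z‖))
  choose Φ hΦ₀ hΦ using exists_norm_avg_sub_avg_le (E := Rn n)
  obtain ⟨C₂, hC₂, hL⟩ := exists_bound_of_finite_range hfin Φ
  have h1 := hω.pos one_pos le_rfl
  set C₀ : ℝ := 1 + 2 / ω 1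
  have hC₀ : 0 ≤ C₀ := by positivity
  refine ⟨C₀ * (C₁ + C₂ + 1), by positivity, fun a ha p ↦ ?_⟩
  have hl : (0 : ℝ) < 2 ^ (-p) := by positivity
  have hA : 0 ≤ (normC ω a).toReal := ENNReal.toReal_nonneg
  have hw : 0 ≤ extend ω ((2 : ℝ) ^ (-p)) := hω.extend_nonneg hl.le
  have hB := ha.norm_sub_smul_sub_le hω hl
  obtain ⟨hT, hR⟩ := hrep p _ _ (isRep_ofBounded (ha.memLp hω))
  refine ⟨_, hT, hR, fun x ↦ ?_, fun x y ↦ ?_⟩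
  · rcases le_or_gt 0 p with hp | hp
    · have h₂ := norm_avg_sub_le (ha.isTempered hω) (KS p) hl hB x
      rw [hint p hp, one_mul] at h₂
      calc _ ≤ C₀ * (normC ω a).toReal * extend ω ((2 : ℝ) ^ (-p)) * C₁ := by
            refine h₂.trans ?_
            gcongr
            exact hI p
        _ = C₀ * C₁ * (normC ω a).toReal * extend ω ((2 : ℝ) ^ (-p)) := by ring
        _ ≤ _ := by gcongr; linarith
    -- For p < 0 the cut-off vanishes and the error is a itself; this is harmless because the
    -- extended modulus is then ω(1).
    · have h₂ : avg (KS p) ((2 : ℝ) ^ (-p)) a x = 0 := by simp [avg, hneg p hp]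
      rw [h₂, zero_sub, norm_neg]
      have h₃ : (1 : ℝ) ≤ 2 ^ (-p) := one_le_zpow₀ one_le_two (by omega)
      refine (ha.norm_le_extend hω h₃ x).trans ?_
      gcongr
      nlinarith
  · refine (hΦ (KS p) (ha.isTempered hω) hl (by positivity) hB x y).trans ?_
    rw [zpow_neg, inv_inv, ← zpow_neg]
    calc _ ≤ C₂ * (C₀ * (normC ω a).toReal * extend ω ((2 : ℝ) ^ (-p))) * 2 ^ p * ‖x - y‖ := by
          gcongr; exact hL p
      _ = C₀ * C₂ * (normC ω a).toReal * extend ω ((2 : ℝ) ^ (-p)) * 2 ^ p * ‖x - y‖ := by ring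
      _ ≤ _ := by gcongr; linarith

/-- Bounds for the dyadic blocks of `a ∈ C^ω`. -/
theorem exists_Delta_bounds (h : IsDyadicPartition χ φ) (hω : IsModulus ω) :
    ∃ C : ℝ, 0 ≤ C ∧ ∀ (a : Rn n → ℂ) (ha : MemC ω a) (q : ℤ), ∃ F : Rn n → ℂ,
      IsRep (Delta χ φ q (ofBounded a (ha.memLp hω))) F ∧
      ∀ x, ‖F x‖ ≤ C * (normC ω a).toReal * extend ω ((2 : ℝ) ^ (-q)) := by
  obtain ⟨KD, -, ⟨hfin, hint, hrep⟩, -⟩ := h.exists_kernels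
  obtain ⟨C₁, hC₁, hI⟩ := exists_bound_of_finite_range hfin (fun K ↦ ∫ z, ‖K z‖ * (1 + ‖z‖))
  obtain ⟨C₂, hC₂, hJ⟩ := exists_bound_of_finite_range hfin (fun K ↦ ‖∫ z, K z‖)
  have h1 := hω.pos one_pos le_rfl
  set C₀ : ℝ := 1 + 2 / ω 1
  have hC₀ : 0 ≤ C₀ := by positivity
  refine ⟨C₀ * (C₁ + C₂), by positivity, fun a ha q ↦ ?_⟩
  have hl : (0 : ℝ) < 2 ^ (-q) := by positivity
  have hA : 0 ≤ (normC ω a).toReal := ENNReal.toReal_nonneg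
  have hw : 0 ≤ extend ω ((2 : ℝ) ^ (-q)) := hω.extend_nonneg hl.le
  have hB := ha.norm_sub_smul_sub_le hω hl
  have hR := (hrep q _ _ (isRep_ofBounded (ha.memLp hω))).2
  refine ⟨_, hR, fun x ↦ ?_⟩
  have h₂ : ‖avg (KD q) ((2 : ℝ) ^ (-q)) a x - (∫ z, KD q z) * a x‖ ≤
      C₀ * (normC ω a).toReal * extend ω ((2 : ℝ) ^ (-q)) * C₁ := by
    refine (norm_avg_sub_le (ha.isTempered hω) (KD q) hl hB x).trans ?_
    gcongr
    exact hI q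
  have h₃ : ‖(∫ z, KD q z) * a x‖ ≤
      C₂ * (C₀ * (normC ω a).toReal * extend ω ((2 : ℝ) ^ (-q))) := by
    rcases le_or_gt 0 q with hq | hq
    · rw [hint q hq, zero_mul, norm_zero]
      positivity
    -- No cancellation is available for q < 0, so the boundedness of a takes its place.
    · have h₃ : (1 : ℝ) ≤ 2 ^ (-q) := one_le_zpow₀ one_le_two (by omega)
      rw [norm_mul]
      gcongr
      · exact hJ q
      · exact ha.norm_le_extend hω h₃ x
  have h₄ := norm_add_le (avg (KD q) ((2 : ℝ) ^ (-q)) a x - (∫ z, KD q z) * a x)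
    ((∫ z, KD q z) * a x)
  rw [sub_add_cancel] at h₄
  linarith

theorem IsModulus.extend_zpow_le (hω : IsModulus ω) {p q : ℤ} (k : ℕ) (h : q - p ≤ k) :
    extend ω ((2 : ℝ) ^ (-p)) ≤ 2 ^ k * extend ω ((2 : ℝ) ^ (-q)) := by
  refine (hω.extend_mono (by positivity) ?_).trans
    (hω.extend_mul_le_of_one_le (one_le_pow₀ one_le_two) (by positivity))
  rw [← zpow_natCast, ← zpow_add₀ two_ne_zero]
  exact zpow_le_zpow_right₀ one_le_two (by omega)

theorem exists_R1_term_le (h : IsDyadicPartition χ φ) (hω : IsModulus ω) :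
    ∃ C : ℝ≥0, ∀ (a : Rn n → ℂ) (ha : MemC ω a) (v : 𝓢'(Rn n, ℂ)) (q q' : ℤ),
      q' ∈ Finset.Icc (q - 4) (q + 4) → L2norm v < ∞ →
      L2norm (Delta χ φ q (mul (S χ (q' - 1) (ofBounded a (ha.memLp hω))) v) -
        mul (S χ (q' - 1) (ofBounded a (ha.memLp hω))) (Delta χ φ q v)) ≤
      C * normC ω a * ENNReal.ofReal (extend ω ((2 : ℝ) ^ (-q))) * L2norm v := by
  obtain ⟨C₁, hC₁⟩ := exists_L2norm_commutator_le h
  obtain ⟨C₂, hC₂₀, hC₂⟩ := exists_S_bounds h hω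
  -- 256 = 2⁵ · 2³: since q' - 1 ≥ q - 5 the modulus loses at most 2⁵, and since q' - 1 ≤ q + 3 the
  -- product 2^{q'-1} 2^{-q} is at most 2³.
  refine ⟨C₁ * ((C₂ * 256).toNNReal), fun a ha v q q' hq' hv ↦ ?_⟩
  rw [Finset.mem_Icc] at hq'
  obtain ⟨F, hF, hu, -, hL⟩ := hC₂ a ha (q' - 1)
  have hA : 0 ≤ (normC ω a).toReal := ENNReal.toReal_nonneg
  have hw : 0 ≤ extend ω ((2 : ℝ) ^ (-(q' - 1))) := hω.extend_nonneg (by positivity)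
  have hw' : 0 ≤ extend ω ((2 : ℝ) ^ (-q)) := hω.extend_nonneg (by positivity)
  set L := C₂ * (normC ω a).toReal * extend ω ((2 : ℝ) ^ (-(q' - 1))) * (2 : ℝ) ^ (q' - 1)
  have hL₀ : 0 ≤ L := by positivity
  have hLip : LipschitzWith L.toNNReal F := LipschitzWith.of_dist_le_mul fun x y ↦ by
    rw [dist_eq_norm, dist_eq_norm, Real.coe_toNNReal _ hL₀]
    exact hL x y
  refine (hC₁ q _ v F L.toNNReal hF hLip hu hv).trans ?_
  have h₁ : L * (2 : ℝ) ^ (-q) ≤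
      C₂ * 256 * (normC ω a).toReal * extend ω ((2 : ℝ) ^ (-q)) := by
    have h₂ : (2 : ℝ) ^ (q' - 1) * (2 : ℝ) ^ (-q) ≤ 2 ^ (3 : ℤ) := by
      rw [← zpow_add₀ two_ne_zero]
      exact zpow_le_zpow_right₀ one_le_two (by omega)
    have h₃ := hω.extend_zpow_le (p := q' - 1) (q := q) 5 (by push_cast; omega)
    calc L * (2 : ℝ) ^ (-q) = C₂ * (normC ω a).toReal * extend ω ((2 : ℝ) ^ (-(q' - 1))) *
          ((2 : ℝ) ^ (q' - 1) * (2 : ℝ) ^ (-q)) := by ring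
      _ ≤ C₂ * (normC ω a).toReal * (2 ^ 5 * extend ω ((2 : ℝ) ^ (-q))) * 2 ^ (3 : ℤ) := by gcongr
      _ = _ := by norm_num; ring
  clear_value L
  have h₄ := ENNReal.ofReal_le_ofReal h₁
  rw [ENNReal.ofReal_mul hL₀, ENNReal.ofReal_mul (by positivity),
    ENNReal.ofReal_mul (by positivity), ENNReal.ofReal_toReal (ha.normC_lt_top hω).ne] at h₄
  calc C₁ * ENNReal.ofReal L * ENNReal.ofReal ((2 : ℝ) ^ (-q)) * L2norm v
      = C₁ * (ENNReal.ofReal L * ENNReal.ofReal ((2 : ℝ) ^ (-q))) * L2norm v := by ring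
    _ ≤ C₁ * (ENNReal.ofReal (C₂ * 256) * normC ω a *
        ENNReal.ofReal (extend ω ((2 : ℝ) ^ (-q)))) * L2norm v := by gcongr
    _ = _ := by rw [ENNReal.coe_mul, ENNReal.ofReal]; ring

theorem exists_R2_term_le (h : IsDyadicPartition χ φ) (hω : IsModulus ω) :
    ∃ C : ℝ≥0, ∀ (a : Rn n → ℂ) (ha : MemC ω a) (v : 𝓢'(Rn n, ℂ)) (q q' : ℤ),
      q' ∈ Finset.Icc (q - 4) (q + 4) → L2norm v < ∞ →
      L2norm (mul (S χ (q' - 1) (ofBounded a (ha.memLp hω)) -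
        S χ (q - 1) (ofBounded a (ha.memLp hω))) (Delta χ φ q v)) ≤
      C * normC ω a * ENNReal.ofReal (extend ω ((2 : ℝ) ^ (-q))) * L2norm v := by
  obtain ⟨C₁, hC₁⟩ := exists_L2norm_Delta_le h
  obtain ⟨C₂, hC₂₀, hC₂⟩ := exists_S_bounds h hω
  -- 64 = 2 · 2⁵: both cut-offs are compared with a, each at an index at least q - 5.
  refine ⟨(C₂ * 64).toNNReal * C₁, fun a ha v q q' hq' hv ↦ ?_⟩
  rw [Finset.mem_Icc] at hq'
  obtain ⟨F, hF, hu, hFa, -⟩ := hC₂ a ha (q' - 1)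
  obtain ⟨G, hG, hu', hGa, -⟩ := hC₂ a ha (q - 1)
  have hA : 0 ≤ (normC ω a).toReal := ENNReal.toReal_nonneg
  have hw' : 0 ≤ extend ω ((2 : ℝ) ^ (-q)) := hω.extend_nonneg (by positivity)
  have hD := hC₁ q v hv
  have hFG : ∀ x, ‖(F - G) x‖ ≤
      C₂ * 64 * (normC ω a).toReal * extend ω ((2 : ℝ) ^ (-q)) := fun x ↦ by
    have h₁ := hω.extend_zpow_le (p := q' - 1) (q := q) 5 (by push_cast; omega)
    have h₂ := hω.extend_zpow_le (p := q - 1) (q := q) 5 (by push_cast; omega)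
    calc ‖(F - G) x‖ = ‖(F x - a x) - (G x - a x)‖ := by rw [Pi.sub_apply]; ring_nf
      _ ≤ ‖F x - a x‖ + ‖G x - a x‖ := norm_sub_le _ _
      _ ≤ C₂ * (normC ω a).toReal * (2 ^ 5 * extend ω ((2 : ℝ) ^ (-q))) +
          C₂ * (normC ω a).toReal * (2 ^ 5 * extend ω ((2 : ℝ) ^ (-q))) := by
        refine add_le_add ((hFa x).trans ?_) ((hGa x).trans ?_) <;> gcongr
      _ = _ := by ring
  refine (L2norm_mul_le (hF.sub hG) (hu.sub hu') hFG (hD.trans_lt (by finiteness))).trans ?_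
  rw [ENNReal.ofReal_mul (by positivity), ENNReal.ofReal_mul (by positivity),
    ENNReal.ofReal_toReal (ha.normC_lt_top hω).ne]
  calc _ ≤ ENNReal.ofReal (C₂ * 64) * normC ω a * ENNReal.ofReal (extend ω ((2 : ℝ) ^ (-q))) *
        (C₁ * L2norm v) := by gcongr
    _ = _ := by rw [ENNReal.coe_mul, ENNReal.ofReal]; ring

end Blocks

/-! ### Low frequencies of b and the single terms of R3 -/

section LowFrequency

variable {n : ℕ} {χ φ : Rn n → ℝ} {ω : ℝ → ℝ}

/-- The partition identity at ξ/2 is the one at ξ with its first term removed from the series. -/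
theorem IsDyadicPartition.phi_eq (h : IsDyadicPartition χ φ) (ξ : Rn n) :
    φ ξ = χ ((2 : ℝ)⁻¹ • ξ) - χ ξ := by
  have h₁ := h.hasSum ξ
  have h₂ := h.hasSum ((2 : ℝ)⁻¹ • ξ)
  have h₃ : HasSum (fun q : ℕ ↦ φ ((2 : ℝ) ^ (-((q + 1 : ℕ) : ℤ)) • ξ)) (1 - χ ((2 : ℝ)⁻¹ • ξ)) := by
    convert h₂ using 3 with q
    rw [smul_smul]
    congr 1
    rw [Nat.cast_succ, neg_add, zpow_add₀ two_ne_zero, zpow_neg_one]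
  have h₄ := (hasSum_nat_add_iff (f := fun q : ℕ ↦ φ ((2 : ℝ) ^ (-(q : ℤ)) • ξ)) 1).1 h₃
  have h₅ := h₁.unique h₄
  simp at h₅
  linarith

theorem hasTemperateGrowth_symbol {m : Rn n → ℝ} (hm : ContDiff ℝ (⊤ : ℕ∞) m)
    (hs : HasCompactSupport m) (q : ℤ) :
    (fun ξ : Rn n ↦
      ((m ((2 : ℝ) ^ (-q) • (2 * Real.pi) • ξ) : ℝ) : ℂ)).HasTemperateGrowth := by
  have hπ : 2 * Real.pi ≠ 0 := by positivity
  have hq : (2 : ℝ) ^ (-q) ≠ 0 := by positivity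
  refine HasCompactSupport.hasTemperateGrowth ?_ ?_
  · exact ((hs.comp_smul hq).comp_smul hπ).comp_left (g := Complex.ofReal) Complex.ofReal_zero
  · exact Complex.ofRealCLM.contDiff.comp
      (hm.comp ((contDiff_const_smul _).comp (contDiff_const_smul _)))

theorem IsDyadicPartition.S_succ (h : IsDyadicPartition χ φ) (N : ℕ) :
    S χ ((N + 1 : ℕ) : ℤ) = S χ N + Delta χ φ N := by
  have h₁ := hasTemperateGrowth_symbol h.contDiff_chi h.hasCompactSupport_chi N
  have h₂ := hasTemperateGrowth_symbol h.contDiff_phi h.hasCompactSupport_phi N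
  set f₁ := fun ξ : Rn n ↦ ((χ ((2 : ℝ) ^ (-(N : ℤ)) • (2 * Real.pi) • ξ) : ℝ) : ℂ) with hf₁
  set f₂ := fun ξ : Rn n ↦ ((φ ((2 : ℝ) ^ (-(N : ℤ)) • (2 * Real.pi) • ξ) : ℝ) : ℂ) with hf₂
  have h₃ := TemperedDistribution.fourierMultiplierCLM_sum ℂ (s := Finset.univ) (g := ![f₁, f₂])
    (fun i _ ↦ by fin_cases i <;> [exact h₁; exact h₂])
  simp only [Fin.sum_univ_two, Matrix.cons_val_zero, Matrix.cons_val_one] at h₃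
  rw [S, if_pos (by omega), S, if_pos (by omega), Delta, if_neg (by omega), if_neg (by omega)]
  rw [dyadicMultiplier, dyadicMultiplier, dyadicMultiplier, ← hf₁, ← hf₂, ← h₃]
  congr 1
  ext ξ
  simp only [hf₁, hf₂]
  rw [h.phi_eq, smul_smul (2 : ℝ)⁻¹]
  have : (2 : ℝ) ^ (-((N + 1 : ℕ) : ℤ)) = 2⁻¹ * 2 ^ (-(N : ℤ)) := by
    rw [Nat.cast_succ, neg_add, zpow_add₀ two_ne_zero, zpow_neg_one, mul_comm]
  rw [this]
  push_cast
  ring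

theorem IsDyadicPartition.S_eq_sum (h : IsDyadicPartition χ φ) (N : ℕ) :
    S χ N = ∑ p ∈ Finset.Icc (-1 : ℤ) (N - 1), Delta χ φ p := by
  induction N with
  | zero => simp [S, Delta]
  | succ N ih =>
    rw [h.S_succ, ih]
    have : Finset.Icc (-1 : ℤ) (((N + 1 : ℕ) : ℤ) - 1) =
        insert (N : ℤ) (Finset.Icc (-1 : ℤ) (N - 1)) := by
      ext p
      simp only [Finset.mem_Icc, Finset.mem_insert]
      omega
    rw [this, Finset.sum_insert (by simp), add_comm]

/-- On the support of χ one has |η/4| ≤ 1/3 < 3/4, where χ equals 1. -/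
theorem IsDyadicPartition.S_S (h : IsDyadicPartition χ φ) {N : ℤ} (hN : 0 ≤ N)
    (u : 𝓢'(Rn n, ℂ)) : S χ (N + 2) (S χ N u) = S χ N u := by
  rw [S, if_pos (by omega), S, if_pos hN, dyadicMultiplier, dyadicMultiplier,
    TemperedDistribution.fourierMultiplierCLM_fourierMultiplierCLM_apply
      (hasTemperateGrowth_symbol h.contDiff_chi h.hasCompactSupport_chi N)
      (hasTemperateGrowth_symbol h.contDiff_chi h.hasCompactSupport_chi (N + 2))]
  congr 2
  ext ξ
  simp only [Pi.mul_apply]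
  set η := (2 : ℝ) ^ (-N) • (2 * Real.pi) • ξ
  have hη : (2 : ℝ) ^ (-(N + 2)) • (2 * Real.pi) • ξ = (4 : ℝ)⁻¹ • η := by
    rw [smul_smul (4 : ℝ)⁻¹]
    congr 1
    rw [neg_add, zpow_add₀ two_ne_zero, mul_comm]
    norm_num
  rw [hη]
  rcases lt_or_ge (4 / 3) ‖η‖ with h₁ | h₁
  · simp [h.chi_eq_zero h₁]
  · rw [h.chi_eq_one (ξ := (4 : ℝ)⁻¹ • η), Complex.ofReal_one, mul_one]
    rw [norm_smul]
    norm_num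
    linarith

theorem IsDyadicPartition.L2norm_S_le (h : IsDyadicPartition χ φ) {N : ℤ} (hN : 0 ≤ N)
    (u : 𝓢'(Rn n, ℂ)) :
    L2norm (S χ N u) ≤ ∑ p ∈ Finset.Icc (-1 : ℤ) (N - 1), L2norm (Delta χ φ p u) := by
  lift N to ℕ using hN
  rw [h.S_eq_sum, _root_.sum_apply]
  exact L2norm_sum_le _ _

/-- The product needs a smooth factor, while b is only a distribution and S_N b is known merely to
be in L². Applying S_{N+2} leaves S_N b unchanged and exhibits it as a convolution with a Schwartz
function. -/
theorem IsDyadicPartition.exists_isRep_S (h : IsDyadicPartition χ φ) {N : ℤ} (hN : 0 ≤ N)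
    {u : 𝓢'(Rn n, ℂ)} (hu : L2norm (S χ N u) < ∞) :
    ∃ F : Rn n → ℂ, F.HasTemperateGrowth ∧ IsRep (S χ N u) F ∧
      eLpNorm F 2 volume = L2norm (S χ N u) := by
  obtain ⟨-, KS, -, -, -, -, hrep⟩ := h.exists_kernels
  obtain ⟨w, hw, -, hw'⟩ := exists_memLp_of_L2norm_lt_top hu
  obtain ⟨hT, hR⟩ := hrep (N + 2) _ w hw
  rw [h.S_S hN] at hR
  exact ⟨_, hT, hR, by rw [← hw', eLpNorm_congr_ae (hR.ae_eq hw)]⟩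

theorem mul_zero_right (u : 𝓢'(Rn n, ℂ)) : mul u 0 = 0 := map_zero _

theorem R3term_eq_zero (a b : 𝓢'(Rn n, ℂ)) (q : ℤ) {q' : ℤ} (hq' : q' < -1) :
    R3term χ φ a b q q' = 0 := by
  have : Delta χ φ q' = 0 := by rw [Delta, if_pos (by omega)]
  rw [R3term, this, _root_.zero_apply, mul_zero_right, map_zero]

/-- Here the smooth factor comes from b and is measured in L², as a sum of blocks, while the block
of a is measured in L^∞. -/
theorem exists_R3term_le (h : IsDyadicPartition χ φ) (hω : IsModulus ω) :
    ∃ C : ℝ≥0, ∀ (a : Rn n → ℂ) (ha : MemC ω a) (b : 𝓢'(Rn n, ℂ)) (q q' : ℤ),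
      (∀ p, L2norm (Delta χ φ p b) < ∞) → -1 ≤ q' →
      L2norm (R3term χ φ (ofBounded a (ha.memLp hω)) b q q') ≤
      C * normC ω a * (ENNReal.ofReal (extend ω ((2 : ℝ) ^ (-q'))) *
        ∑ p ∈ Finset.Icc (-1 : ℤ) (q' + 1), L2norm (Delta χ φ p b)) := by
  obtain ⟨C₁, hC₁⟩ := exists_L2norm_Delta_le h
  obtain ⟨C₂, hC₂₀, hC₂⟩ := exists_Delta_bounds h hω
  refine ⟨C₁ * C₂.toNNReal, fun a ha b q q' hb hq' ↦ ?_⟩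
  have hS := h.L2norm_S_le (N := q' + 2) (by omega) b
  rw [show q' + 2 - 1 = q' + 1 by ring] at hS
  have hfin : L2norm (S χ (q' + 2) b) < ∞ :=
    hS.trans_lt (ENNReal.sum_lt_top.2 fun p _ ↦ hb p)
  obtain ⟨F, hF, hu, hF'⟩ := h.exists_isRep_S (by omega) hfin
  obtain ⟨G, hv, hG⟩ := hC₂ a ha q'
  have hA : 0 ≤ (normC ω a).toReal := ENNReal.toReal_nonneg
  have hmul : L2norm (mul (S χ (q' + 2) b) (Delta χ φ q' (ofBounded a (ha.memLp hω)))) ≤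
      ENNReal.ofReal (C₂ * (normC ω a).toReal * extend ω ((2 : ℝ) ^ (-q'))) *
        ∑ p ∈ Finset.Icc (-1 : ℤ) (q' + 1), L2norm (Delta χ φ p b) := by
    refine (hu.mul hF hv).L2norm_le.trans (le_trans ?_ (mul_le_mul_right (hF'.trans_le hS) _))
    refine eLpNorm_le_mul_eLpNorm_of_ae_le_mul (.of_forall fun x ↦ ?_) 2
    rw [norm_mul, mul_comm]
    gcongr
    exact hG x
  rw [R3term]
  refine (hC₁ q _ (hmul.trans_lt ?_)).trans ?_
  · exact ENNReal.mul_lt_top ENNReal.ofReal_lt_top (ENNReal.sum_lt_top.2 fun p _ ↦ hb p)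
  · grw [hmul]
    rw [ENNReal.ofReal_mul (by positivity), ENNReal.ofReal_mul hC₂₀,
      ENNReal.ofReal_toReal (ha.normC_lt_top hω).ne, ENNReal.coe_mul, ENNReal.ofReal]
    exact le_of_eq (by ring)

end LowFrequency

/-! ### Discrete convolutions and weighted sequence norms -/

section Sequences

theorem tsum_mul_sq_le {ι : Type*} (k c : ι → ℝ≥0∞) :
    (∑' i, k i * c i) ^ 2 ≤ (∑' i, k i) * ∑' i, k i * c i ^ 2 := by
  let : MeasurableSpace ι := ⊤
  have h := lintegral_mul_sq_le Measure.count (k := k) (W := c) measurable_from_top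
    measurable_from_top
  rwa [lintegral_count, lintegral_count, lintegral_count] at h

/-- Young's inequality `ℓ¹ * ℓ² → ℓ²`. -/
theorem tsum_conv_sq_le (k c : ℤ → ℝ≥0∞) :
    ∑' q, (∑' p, k (q - p) * c p) ^ 2 ≤ (∑' j, k j) ^ 2 * ∑' p, c p ^ 2 := by
  have h₁ : ∀ q, ∑' p, k (q - p) = ∑' j, k j := fun q ↦ (Equiv.subLeft q).tsum_eq k
  have h₂ : ∀ p, ∑' q, k (q - p) = ∑' j, k j := fun p ↦ (Equiv.subRight p).tsum_eq k
  calc ∑' q, (∑' p, k (q - p) * c p) ^ 2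
      ≤ ∑' q, (∑' j, k j) * ∑' p, k (q - p) * c p ^ 2 := by
        refine ENNReal.tsum_le_tsum fun q ↦ ?_
        rw [← h₁ q]
        exact tsum_mul_sq_le _ _
    _ = (∑' j, k j) * ∑' p, ∑' q, k (q - p) * c p ^ 2 := by
        rw [ENNReal.tsum_mul_left, ENNReal.tsum_comm]
    _ = _ := by
        simp_rw [ENNReal.tsum_mul_right, h₂, ENNReal.tsum_mul_left]
        ring

variable {n : ℕ} {χ φ : Rn n → ℝ} {ω : ℝ → ℝ}

/-- The weight `2^{(1-s)q} ω(2^{-q})`. -/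
def weight (ω : ℝ → ℝ) (s : ℝ) (q : ℤ) : ℝ :=
  (2 : ℝ) ^ ((1 - s) * q) * extend ω ((2 : ℝ) ^ (-q))

theorem IsModulus.weight_pos (hω : IsModulus ω) (s : ℝ) (q : ℤ) : 0 < weight ω s q :=
  mul_pos (by positivity) (hω.extend_pos (by positivity))

theorem two_rpow_eq_ofReal (x : ℝ) : (2 : ℝ≥0∞) ^ x = ENNReal.ofReal ((2 : ℝ) ^ x) := by
  rw [← ENNReal.ofReal_rpow_of_pos two_pos]
  simp

/-- Uses 2^{-sq} Ω(q) = 2^{(1-s)q} ω(2^{-q}). The sum may run over all integers because the blocks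
with q ≤ -2 vanish, which lets Young's inequality be used on ℤ. -/
theorem normH_sq (hω : IsModulus ω) (s : ℝ) (u : 𝓢'(Rn n, ℂ)) :
    normH χ φ ω (-s) u ^ 2 =
      ∑' q : ℤ, (ENNReal.ofReal (weight ω s q) * L2norm (Delta χ φ q u)) ^ 2 := by
  have h₁ : ∀ q : ℤ, (2 : ℝ≥0∞) ^ (2 * (-s) * (q : ℝ)) * ENNReal.ofReal (Omega ω q) ^ 2 *
      L2norm (Delta χ φ q u) ^ 2 =
        (ENNReal.ofReal (weight ω s q) * L2norm (Delta χ φ q u)) ^ 2 := fun q ↦ by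
    have hΩ : 0 ≤ Omega ω q := mul_nonneg (by positivity) (hω.extend_nonneg (by positivity))
    rw [mul_pow, ← ENNReal.ofReal_pow hΩ, ← ENNReal.ofReal_pow (hω.weight_pos s q).le,
      two_rpow_eq_ofReal, ← ENNReal.ofReal_mul (by positivity)]
    congr 2
    rw [Omega, weight, ← Real.rpow_intCast, mul_pow, mul_pow, ← mul_assoc, extend]
    congr 1
    rw [← Real.rpow_natCast, ← Real.rpow_natCast, ← Real.rpow_mul zero_le_two,
      ← Real.rpow_mul zero_le_two, ← Real.rpow_add two_pos]
    push_cast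
    ring_nf
  rw [normH, ← ENNReal.rpow_two, ← ENNReal.rpow_mul]
  simp_rw [h₁]
  norm_num
  rw [tsum_subtype (Set.Ici (-1 : ℤ))
    fun q ↦ (ENNReal.ofReal (weight ω s q) * L2norm (Delta χ φ q u)) ^ 2]
  congr 1 with q
  rw [Set.indicator_apply]
  split_ifs with hq
  · rfl
  · have : Delta χ φ q = 0 := by
      rw [Delta, if_pos (by simp at hq; omega)]
    simp [this, L2norm_zero]

theorem L2norm_Delta_lt_top (hω : IsModulus ω) {s : ℝ} {u : 𝓢'(Rn n, ℂ)}
    (hu : MemH χ φ ω (-s) u) (q : ℤ) : L2norm (Delta χ φ q u) < ∞ := by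
  have h₁ : normH χ φ ω (-s) u ^ 2 < ∞ := ENNReal.pow_lt_top hu
  rw [normH_sq hω] at h₁
  have h₂ := (ENNReal.le_tsum q).trans_lt h₁
  rw [ENNReal.pow_lt_top_iff] at h₂
  rcases h₂ with h₂ | h₂
  · refine lt_top_iff_ne_top.2 fun h₃ ↦ h₂.ne ?_
    rw [h₃, ENNReal.mul_top]
    simpa using hω.weight_pos s q
  · simp at h₂

theorem dyadicNorm_le {σ : ℝ} {u : ℤ → 𝓢'(Rn n, ℂ)} {B T : ℝ≥0∞} {e : ℤ → ℝ≥0∞}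
    (h : ∀ q : ℤ, -1 ≤ q → (2 : ℝ≥0∞) ^ (σ * (q : ℝ)) * L2norm (u q) ≤ B * e q)
    (he : ∑' q, e q ^ 2 ≤ T ^ 2) : dyadicNorm σ u ≤ B * T := by
  refine (ENNReal.pow_le_pow_left_iff two_ne_zero).1 ?_
  rw [dyadicNorm, ← ENNReal.rpow_two, ← ENNReal.rpow_mul]
  norm_num
  calc ∑' q : Set.Ici (-1 : ℤ), (2 : ℝ≥0∞) ^ (2 * σ * ((q : ℤ) : ℝ)) * L2norm (u q) ^ 2
      ≤ ∑' q : Set.Ici (-1 : ℤ), B ^ 2 * e q ^ 2 := by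
        refine ENNReal.tsum_le_tsum fun q ↦ ?_
        have := pow_le_pow_left₀ (by simp) (h q q.2) 2
        rw [mul_pow, mul_pow, ← ENNReal.rpow_two (2 ^ _), ← ENNReal.rpow_mul] at this
        rwa [show σ * ((q : ℤ) : ℝ) * 2 = 2 * σ * ((q : ℤ) : ℝ) by ring] at this
    _ ≤ ∑' q, B ^ 2 * e q ^ 2 := ENNReal.tsum_comp_le_tsum_of_injective Subtype.val_injective _
    _ ≤ (B * T) ^ 2 := by rw [ENNReal.tsum_mul_left, mul_pow]; gcongr

end Sequences

/-! ### Summation over the dyadic index and the three remainders -/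

section Remainders

variable {n : ℕ} {χ φ : Rn n → ℝ} {ω : ℝ → ℝ}

theorem IsModulus.weight_le (hω : IsModulus ω) (s : ℝ) {q q' : ℤ}
    (h : q' ∈ Finset.Icc (q - 4) (q + 4)) :
    weight ω s q ≤ (2 : ℝ) ^ (4 * |1 - s|) * 2 ^ 4 * weight ω s q' := by
  rw [Finset.mem_Icc] at h
  have h₁ := hω.extend_zpow_le (p := q) (q := q') 4 (by push_cast; omega)
  have h₂ : (2 : ℝ) ^ ((1 - s) * q) ≤ (2 : ℝ) ^ (4 * |1 - s|) * (2 : ℝ) ^ ((1 - s) * q') := by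
    rw [← Real.rpow_add two_pos]
    refine Real.rpow_le_rpow_of_exponent_le one_le_two ?_
    have h₃ : |(q : ℝ) - q'| ≤ 4 := by
      rw [abs_le]
      constructor <;> norm_cast <;> omega
    have h₄ : (1 - s) * (q - q') ≤ |1 - s| * 4 :=
      (le_abs_self _).trans (by rw [abs_mul]; gcongr)
    linarith
  calc weight ω s q ≤ ((2 : ℝ) ^ (4 * |1 - s|) * (2 : ℝ) ^ ((1 - s) * q')) *
        (2 ^ 4 * extend ω ((2 : ℝ) ^ (-q'))) :=
        mul_le_mul h₂ h₁ (hω.extend_nonneg (by positivity)) (by positivity)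
    _ = _ := by rw [weight]; ring

theorem two_rpow_mul_ofReal_extend (s : ℝ) (q : ℤ) :
    (2 : ℝ≥0∞) ^ ((1 - s) * (q : ℝ)) * ENNReal.ofReal (extend ω ((2 : ℝ) ^ (-q))) =
      ENNReal.ofReal (weight ω s q) := by
  rw [two_rpow_eq_ofReal, ← ENNReal.ofReal_mul (by positivity), weight]

/-- A family dominated by the neighbouring dyadic blocks of `b`, with a factor `ω(2^{-q})`. -/
theorem exists_dyadicNorm_le_of_local (hω : IsModulus ω) (s : ℝ) :
    ∃ M : ℝ≥0, ∀ (u : ℤ → 𝓢'(Rn n, ℂ)) (b : 𝓢'(Rn n, ℂ)) (A : ℝ≥0∞),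
      (∀ q, L2norm (u q) ≤ ∑ q' ∈ Finset.Icc (q - 4) (q + 4),
        A * ENNReal.ofReal (extend ω ((2 : ℝ) ^ (-q))) * L2norm (Delta χ φ q' b)) →
      dyadicNorm (1 - s) u ≤ M * A * normH χ φ ω (-s) b := by
  set M₀ : ℝ := (2 : ℝ) ^ (4 * |1 - s|) * 2 ^ 4
  have hM₀ : 0 ≤ M₀ := by positivity
  -- The sum over nine neighbours becomes a convolution with this indicator, of ℓ¹ norm 9.
  set k : ℤ → ℝ≥0∞ := fun j ↦ if j ∈ Finset.Icc (-4 : ℤ) 4 then 1 else 0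
  have hk : ∑' j, k j = 9 := by
    rw [tsum_eq_sum (s := Finset.Icc (-4 : ℤ) 4) (fun j hj ↦ if_neg hj),
      Finset.sum_congr rfl (fun j hj ↦ if_pos hj)]
    simp
  refine ⟨M₀.toNNReal * 9, fun u b A h ↦ ?_⟩
  set c : ℤ → ℝ≥0∞ := fun q ↦ ENNReal.ofReal (weight ω s q) * L2norm (Delta χ φ q b)
  have he := tsum_conv_sq_le k c
  rw [hk, ← normH_sq hω, ← mul_pow] at he
  refine (dyadicNorm_le (B := A * ENNReal.ofReal M₀) (fun q _ ↦ ?_) he).trans_eq ?_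
  · calc (2 : ℝ≥0∞) ^ ((1 - s) * (q : ℝ)) * L2norm (u q)
        ≤ (2 : ℝ≥0∞) ^ ((1 - s) * (q : ℝ)) * ∑ q' ∈ Finset.Icc (q - 4) (q + 4),
          A * ENNReal.ofReal (extend ω ((2 : ℝ) ^ (-q))) * L2norm (Delta χ φ q' b) := by
          gcongr; exact h q
      _ = ∑ q' ∈ Finset.Icc (q - 4) (q + 4),
          A * (ENNReal.ofReal (weight ω s q) * L2norm (Delta χ φ q' b)) := by
          rw [Finset.mul_sum, ← two_rpow_mul_ofReal_extend]
          exact Finset.sum_congr rfl fun q' _ ↦ by ring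
      _ ≤ ∑ q' ∈ Finset.Icc (q - 4) (q + 4), A * ENNReal.ofReal M₀ * (k (q - q') * c q') := by
          refine Finset.sum_le_sum fun q' hq' ↦ ?_
          have h₁ : k (q - q') = 1 := if_pos (by rw [Finset.mem_Icc] at hq' ⊢; omega)
          have h₂ := ENNReal.ofReal_le_ofReal (hω.weight_le s hq')
          rw [ENNReal.ofReal_mul hM₀] at h₂
          rw [h₁, one_mul, mul_assoc, ← mul_assoc (ENNReal.ofReal M₀)]
          gcongr
      _ ≤ A * ENNReal.ofReal M₀ * ∑' q', k (q - q') * c q' := by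
          rw [← Finset.mul_sum]
          gcongr
          exact ENNReal.sum_le_tsum _
  · rw [ENNReal.coe_mul, ENNReal.ofReal]
    push_cast
    ring

theorem exists_R1_le (h : IsDyadicPartition χ φ) (hω : IsModulus ω) (s : ℝ) :
    ∃ C : ℝ≥0, ∀ (a : Rn n → ℂ) (ha : MemC ω a) (b : 𝓢'(Rn n, ℂ)), MemH χ φ ω (-s) b →
      dyadicNorm (1 - s) (R1 χ φ (ofBounded a (ha.memLp hω)) b) ≤
        C * normC ω a * normH χ φ ω (-s) b := by
  obtain ⟨C, hC⟩ := exists_R1_term_le h hω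
  obtain ⟨M, hM⟩ := exists_dyadicNorm_le_of_local (χ := χ) (φ := φ) hω s
  refine ⟨M * C, fun a ha b hb ↦ ?_⟩
  refine (hM _ b (C * normC ω a) fun q ↦ ?_).trans_eq (by rw [ENNReal.coe_mul]; ring)
  exact (L2norm_sum_le _ _).trans
    (Finset.sum_le_sum fun q' hq' ↦ hC a ha _ q q' hq' (L2norm_Delta_lt_top hω hb q'))

theorem exists_R2_le (h : IsDyadicPartition χ φ) (hω : IsModulus ω) (s : ℝ) :
    ∃ C : ℝ≥0, ∀ (a : Rn n → ℂ) (ha : MemC ω a) (b : 𝓢'(Rn n, ℂ)), MemH χ φ ω (-s) b →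
      dyadicNorm (1 - s) (R2 χ φ (ofBounded a (ha.memLp hω)) b) ≤
        C * normC ω a * normH χ φ ω (-s) b := by
  obtain ⟨C, hC⟩ := exists_R2_term_le h hω
  obtain ⟨M, hM⟩ := exists_dyadicNorm_le_of_local (χ := χ) (φ := φ) hω s
  refine ⟨M * C, fun a ha b hb ↦ ?_⟩
  refine (hM _ b (C * normC ω a) fun q ↦ ?_).trans_eq (by rw [ENNReal.coe_mul]; ring)
  exact (L2norm_sum_le _ _).trans
    (Finset.sum_le_sum fun q' hq' ↦ hC a ha _ q q' hq' (L2norm_Delta_lt_top hω hb q'))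

/-- The quotient condition, extended to all pairs of dyadic indices that occur. -/
theorem IsModulus.exists_extend_le_mul (hω : IsModulus ω) (hquot : QuotientCondition ω) :
    ∃ M : ℝ, 0 ≤ M ∧ ∀ p q : ℤ, -1 ≤ p → p ≤ q + 1 →
      extend ω ((2 : ℝ) ^ (-q)) ≤
        M * extend ω ((2 : ℝ) ^ (-(q - p))) * extend ω ((2 : ℝ) ^ (-p)) := by
  obtain ⟨C, hC, h⟩ := hquot
  have h1 := hω.pos one_pos le_rfl
  refine ⟨C + 2 / ω 1, by positivity, fun p q hp hpq ↦ ?_⟩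
  have hnn : ∀ r : ℤ, 0 ≤ extend ω ((2 : ℝ) ^ (-r)) := fun r ↦ hω.extend_nonneg (by positivity)
  have hone : ∀ r : ℤ, r ≤ 0 → extend ω ((2 : ℝ) ^ (-r)) = ω 1 := fun r hr ↦
    extend_of_one_le (one_le_zpow₀ one_le_two (by omega))
  -- For p ≤ 0 the factor at p is ω(1), and q - p ≤ q + 1 costs one doubling.
  rcases lt_or_ge p 1 with hp1 | hp1
  · rw [hone p (by omega)]
    have h₁ := hω.extend_zpow_le (p := q) (q := q - p) 1 (by push_cast; omega)
    calc _ ≤ 2 ^ 1 * extend ω ((2 : ℝ) ^ (-(q - p))) := h₁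
      _ = 2 / ω 1 * extend ω ((2 : ℝ) ^ (-(q - p))) * ω 1 := by field_simp
      _ ≤ _ := by have := hnn (q - p); gcongr; linarith
  -- For p equal to q or q + 1 the factor at q - p is ω(1), again up to one doubling.
  rcases lt_or_ge (q - 1) p with hq | hq
  · rw [hone (q - p) (by omega)]
    have h₁ := hω.extend_zpow_le (p := q) (q := p) 1 (by push_cast; omega)
    calc _ ≤ 2 ^ 1 * extend ω ((2 : ℝ) ^ (-p)) := h₁
      _ = 2 / ω 1 * ω 1 * extend ω ((2 : ℝ) ^ (-p)) := by field_simp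
      _ ≤ _ := by have := hnn p; gcongr; linarith
  · have hle : ∀ r : ℤ, 0 ≤ r → (2 : ℝ) ^ (-r) ≤ 1 := fun r hr ↦
      zpow_le_one_of_nonpos₀ one_le_two (by omega)
    have h₁ := h p q hp1 hq
    rw [div_le_iff₀ (hω.pos (by positivity) (hle p (by omega))), show p - q = -(q - p) by ring] at h₁
    have := hnn (q - p)
    have := hnn p
    rw [extend_of_le_one (hle q (by omega))]
    rw [← extend_of_le_one (ω := ω) (hle p (by omega)),
      ← extend_of_le_one (ω := ω) (hle (q - p) (by omega))] at h₁
    refine h₁.trans ?_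
    gcongr
    have : 0 ≤ 2 / ω 1 := by positivity
    linarith

theorem tsum_ite_rpow_lt_top {t : ℝ} (ht : 0 < t) :
    ∑' i : ℤ, (if i < 4 then ENNReal.ofReal ((2 : ℝ) ^ (t * i)) else 0) < ∞ := by
  have hinj : Function.Injective fun k : ℕ ↦ (3 - k : ℤ) := fun a b h ↦ by
    simp only at h; omega
  rw [← hinj.tsum_eq]
  · have h₁ : ∀ k : ℕ, (2 : ℝ) ^ (t * ((3 - k : ℤ) : ℝ)) = 2 ^ (t * 3) * ((2 : ℝ) ^ (-t)) ^ k :=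
      fun k ↦ by
        rw [← Real.rpow_natCast, ← Real.rpow_mul zero_le_two, ← Real.rpow_add two_pos]
        push_cast
        ring_nf
    have h₂ : ∀ k : ℕ, (3 - k : ℤ) < 4 := fun k ↦ by omega
    simp only [h₁, h₂, if_true]
    have h₃ : (2 : ℝ) ^ (-t) < 1 := Real.rpow_lt_one_of_one_lt_of_neg one_lt_two (by linarith)
    exact ((summable_geometric_of_lt_one (by positivity) h₃).mul_left _).tsum_ofReal_lt_top
  · intro i hi
    have : i < 4 := by
      by_contra h
      simp [h] at hi
    exact ⟨(3 - i).toNat, by simp only; omega⟩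

/-- This is the series condition at σ = s with one extra term, at j = -1, which occurs because p may
reach q' + 1. -/
theorem tsum_ite_weight_lt_top {s : ℝ} (hs₀ : 0 < s) (hs₁ : s < 1) (h : SeriesCondition ω) :
    ∑' j : ℤ, (if -1 ≤ j then ENNReal.ofReal (weight ω s j) else 0) < ∞ := by
  have hinj : Function.Injective fun k : ℕ ↦ (k - 1 : ℤ) := fun a b h ↦ by
    simp only at h; omega
  rw [← hinj.tsum_eq]
  · have h₂ : ∀ k : ℕ, (-1 : ℤ) ≤ k - 1 := fun k ↦ by omega
    simp only [h₂, if_true]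
    refine Summable.tsum_ofReal_lt_top ((summable_nat_add_iff 1).1 ((h s ⟨hs₀, hs₁⟩).congr ?_))
    intro k
    rw [weight, Nat.cast_succ, add_sub_cancel_right, extend_of_le_one]
    · simp
    · exact zpow_le_one_of_nonpos₀ one_le_two (by simp)
  · intro j hj
    have : -1 ≤ j := by
      by_contra h
      simp [h] at hj
    exact ⟨(j + 1).toNat, by simp only; omega⟩

/-- Write q = (q - q') + (q' - p) + p in the exponent and split the modulus by the quotient
condition; the result has the shape of two nested convolutions. -/
theorem IsModulus.exists_weight_le (hω : IsModulus ω) (hquot : QuotientCondition ω) (s : ℝ) :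
    ∃ M : ℝ, 0 ≤ M ∧ ∀ p q q' : ℤ, -1 ≤ p → p ≤ q' + 1 →
      (2 : ℝ) ^ ((1 - s) * q) * extend ω ((2 : ℝ) ^ (-q')) ≤
        M * ((2 : ℝ) ^ ((1 - s) * (q - q' : ℤ)) * (weight ω s (q' - p) * weight ω s p)) := by
  obtain ⟨M, hM₀, hM⟩ := hω.exists_extend_le_mul hquot
  refine ⟨M, hM₀, fun p q q' hp hpq ↦ ?_⟩
  have h₁ : (2 : ℝ) ^ ((1 - s) * q) = (2 : ℝ) ^ ((1 - s) * (q - q' : ℤ)) *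
      ((2 : ℝ) ^ ((1 - s) * (q' - p : ℤ)) * (2 : ℝ) ^ ((1 - s) * p)) := by
    rw [← Real.rpow_add two_pos, ← Real.rpow_add two_pos]
    push_cast
    ring_nf
  calc _ ≤ (2 : ℝ) ^ ((1 - s) * q) *
        (M * extend ω ((2 : ℝ) ^ (-(q' - p))) * extend ω ((2 : ℝ) ^ (-p))) := by
        gcongr
        exact hM p q' hp hpq
    _ = _ := by rw [h₁, weight, weight]; ring

theorem exists_R3_le (h : IsDyadicPartition χ φ) (hω : IsModulus ω) {s : ℝ} (hs₀ : 0 < s)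
    (hs₁ : s < 1) (hquot : QuotientCondition ω) (hser : SeriesCondition ω) :
    ∃ C : ℝ≥0, ∀ (a : Rn n → ℂ) (ha : MemC ω a) (b : 𝓢'(Rn n, ℂ)), MemH χ φ ω (-s) b →
      (∀ q : ℤ, -1 ≤ q → Summable fun q' : Set.Ioi (q - 4) ↦
        R3term χ φ (ofBounded a (ha.memLp hω)) b q q') ∧
      dyadicNorm (1 - s) (R3 χ φ (ofBounded a (ha.memLp hω)) b) ≤
        C * normC ω a * normH χ φ ω (-s) b := by
  obtain ⟨C, hC⟩ := exists_R3term_le h hω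
  obtain ⟨M, hM₀, hM⟩ := hω.exists_weight_le hquot s
  set m : ℤ → ℝ≥0∞ := fun i ↦ if i < 4 then ENNReal.ofReal ((2 : ℝ) ^ ((1 - s) * i)) else 0
  set g : ℤ → ℝ≥0∞ := fun j ↦ if -1 ≤ j then ENNReal.ofReal (weight ω s j) else 0
  have hm : ∑' i, m i < ∞ := tsum_ite_rpow_lt_top (by linarith)
  have hg : ∑' j, g j < ∞ := tsum_ite_weight_lt_top hs₀ hs₁ hser
  refine ⟨C * M.toNNReal * ((∑' i, m i).toNNReal * (∑' j, g j).toNNReal), fun a ha b hb ↦ ?_⟩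
  set c : ℤ → ℝ≥0∞ := fun q ↦ ENNReal.ofReal (weight ω s q) * L2norm (Delta χ φ q b)
  set d : ℤ → ℝ≥0∞ := fun q' ↦ ∑' p, g (q' - p) * c p
  set e : ℤ → ℝ≥0∞ := fun q ↦ ∑' q', m (q - q') * d q'
  set T := (∑' i, m i) * (∑' j, g j) * normH χ φ ω (-s) b
  have hT : T < ∞ := ENNReal.mul_lt_top (ENNReal.mul_lt_top hm hg) hb
  -- Young's inequality twice: first for the convolution with m, then for the one with g.
  have he : ∑' q, e q ^ 2 ≤ T ^ 2 := by
    refine (tsum_conv_sq_le m d).trans ?_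
    grw [tsum_conv_sq_le g c, ← normH_sq hω]
    exact le_of_eq (by ring)
  have hterm : ∀ q q' : ℤ, q - 4 < q' → (2 : ℝ≥0∞) ^ ((1 - s) * (q : ℝ)) *
      L2norm (R3term χ φ (ofBounded a (ha.memLp hω)) b q q') ≤
        C * M.toNNReal * normC ω a * (m (q - q') * d q') := by
    intro q q' hq
    rcases lt_or_ge q' (-1) with hq' | hq'
    · rw [R3term_eq_zero _ _ _ hq', L2norm_zero, mul_zero]
      exact zero_le
    grw [hC a ha b q q' (L2norm_Delta_lt_top hω hb) hq']
    have h₁ : (2 : ℝ≥0∞) ^ ((1 - s) * (q : ℝ)) * (ENNReal.ofReal (extend ω ((2 : ℝ) ^ (-q'))) *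
        ∑ p ∈ Finset.Icc (-1 : ℤ) (q' + 1), L2norm (Delta χ φ p b)) ≤
        M.toNNReal * (m (q - q') * d q') := by
      calc _ = ∑ p ∈ Finset.Icc (-1 : ℤ) (q' + 1),
            ENNReal.ofReal ((2 : ℝ) ^ ((1 - s) * q) * extend ω ((2 : ℝ) ^ (-q'))) *
              L2norm (Delta χ φ p b) := by
            rw [two_rpow_eq_ofReal, ← mul_assoc, ← ENNReal.ofReal_mul (by positivity),
              Finset.mul_sum]
        _ ≤ ∑ p ∈ Finset.Icc (-1 : ℤ) (q' + 1),
            M.toNNReal * (m (q - q') * (g (q' - p) * c p)) := by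
            refine Finset.sum_le_sum fun p hp ↦ ?_
            rw [Finset.mem_Icc] at hp
            have h₂ := ENNReal.ofReal_le_ofReal (hM p q q' hp.1 hp.2)
            rw [ENNReal.ofReal_mul hM₀,
              ENNReal.ofReal_mul (p := (2 : ℝ) ^ ((1 - s) * (q - q' : ℤ))) (by positivity),
              ENNReal.ofReal_mul (hω.weight_pos s _).le] at h₂
            have h₃ : m (q - q') = ENNReal.ofReal ((2 : ℝ) ^ ((1 - s) * (q - q' : ℤ))) :=
              if_pos (by omega)
            have h₄ : g (q' - p) = ENNReal.ofReal (weight ω s (q' - p)) := if_pos (by omega)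
            rw [h₃, h₄]
            refine (mul_le_mul_left h₂ _).trans_eq ?_
            simp only [c, ENNReal.ofReal]
            ring
        _ ≤ M.toNNReal * (m (q - q') * d q') := by
            rw [← Finset.mul_sum, ← Finset.mul_sum]
            gcongr
            exact ENNReal.sum_le_tsum _
    calc _ = C * normC ω a * ((2 : ℝ≥0∞) ^ ((1 - s) * (q : ℝ)) *
          (ENNReal.ofReal (extend ω ((2 : ℝ) ^ (-q'))) *
            ∑ p ∈ Finset.Icc (-1 : ℤ) (q' + 1), L2norm (Delta χ φ p b))) := by ring
      _ ≤ C * normC ω a * (M.toNNReal * (m (q - q') * d q')) := by gcongr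
      _ = _ := by ring
  have hsum : ∀ q : ℤ, (2 : ℝ≥0∞) ^ ((1 - s) * (q : ℝ)) * ∑' q' : Set.Ioi (q - 4),
      L2norm (R3term χ φ (ofBounded a (ha.memLp hω)) b q q') ≤
        C * M.toNNReal * normC ω a * e q := by
    intro q
    rw [← ENNReal.tsum_mul_left, ← ENNReal.tsum_mul_left]
    exact (ENNReal.tsum_le_tsum fun q' : Set.Ioi (q - 4) ↦ hterm q q' q'.2).trans
      (ENNReal.tsum_comp_le_tsum_of_injective Subtype.val_injective
        fun q' ↦ C * M.toNNReal * normC ω a * (m (q - q') * d q'))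
  -- The square-summable majorant is finite at every q, and the weight 2^{(1-s)q} is positive, so
  -- each series of L² norms converges.
  have hfin : ∀ q : ℤ, ∑' q' : Set.Ioi (q - 4),
      L2norm (R3term χ φ (ofBounded a (ha.memLp hω)) b q q') < ∞ := by
    intro q
    have h₁ : e q ^ 2 < ∞ :=
      ((ENNReal.le_tsum q).trans he).trans_lt (ENNReal.pow_lt_top hT)
    have h₂ : e q < ∞ := by simpa using h₁
    have h₃ := (hsum q).trans_lt (ENNReal.mul_lt_top
      (ENNReal.mul_lt_top (by finiteness) (ha.normC_lt_top hω)) h₂)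
    refine lt_top_iff_ne_top.2 fun h₄ ↦ h₃.ne ?_
    rw [h₄, two_rpow_eq_ofReal, ENNReal.mul_top]
    simpa using Real.rpow_pos_of_pos two_pos _
  refine ⟨fun q _ ↦ (summable_of_tsum_L2norm_lt_top (hfin q)).1, ?_⟩
  refine (dyadicNorm_le (B := C * M.toNNReal * normC ω a) (fun q _ ↦ ?_) he).trans_eq ?_
  · refine le_trans ?_ (hsum q)
    gcongr
    exact (summable_of_tsum_L2norm_lt_top (hfin q)).2
  · push_cast
    rw [ENNReal.coe_toNNReal hm.ne, ENNReal.coe_toNNReal hg.ne]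
    ring

end Remainders

end Paradiff

end

theorem mainTheorem3 (n : ℕ) (χ φ : Paradiff.Rn n → ℝ) (hχφ : Paradiff.IsDyadicPartition χ φ)
    (ω : ℝ → ℝ) (hω : Paradiff.IsModulus ω) (hDini : Paradiff.DiniCondition ω) (s : ℝ) :
    (∃ C : ℝ≥0, ∀ (a : Paradiff.Rn n → ℂ) (ha : Paradiff.MemC ω a) (b : 𝓢'(Paradiff.Rn n, ℂ)),
      Paradiff.MemH χ φ ω (-s) b →
        Paradiff.dyadicNorm (1 - s)
            (Paradiff.R1 χ φ (Paradiff.ofBounded a (ha.memLp hω)) b) ≤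
          C * Paradiff.normC ω a * Paradiff.normH χ φ ω (-s) b ∧
        Paradiff.dyadicNorm (1 - s)
            (Paradiff.R2 χ φ (Paradiff.ofBounded a (ha.memLp hω)) b) ≤
          C * Paradiff.normC ω a * Paradiff.normH χ φ ω (-s) b) ∧
    (0 < s → s < 1 → Paradiff.QuotientCondition ω → Paradiff.SeriesCondition ω →
      ∃ C : ℝ≥0, ∀ (a : Paradiff.Rn n → ℂ) (ha : Paradiff.MemC ω a) (b : 𝓢'(Paradiff.Rn n, ℂ)),
        Paradiff.MemH χ φ ω (-s) b →
          (∀ q : ℤ, -1 ≤ q → Summable fun q' : Set.Ioi (q - 4) ↦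
            Paradiff.R3term χ φ (Paradiff.ofBounded a (ha.memLp hω)) b q q') ∧
          Paradiff.dyadicNorm (1 - s)
              (Paradiff.R3 χ φ (Paradiff.ofBounded a (ha.memLp hω)) b) ≤
            C * Paradiff.normC ω a * Paradiff.normH χ φ ω (-s) b) := by
  obtain ⟨C₁, h₁⟩ := Paradiff.exists_R1_le hχφ hω s
  obtain ⟨C₂, h₂⟩ := Paradiff.exists_R2_le hχφ hω s
  refine ⟨⟨max C₁ C₂, fun a ha b hb ↦ ⟨(h₁ a ha b hb).trans ?_, (h₂ a ha b hb).trans ?_⟩⟩,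
    fun hs₀ hs₁ hquot hser ↦ Paradiff.exists_R3_le hχφ hω hs₀ hs₁ hquot hser⟩
  · gcongr
    exact le_max_left _ _
  · gcongr
    exact le_max_right _ _
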